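/- Let $d,\zeta,f,\kappa\in\mathbb{R}$ with $d\neq 0$ and $\kappa\ge 1/\sqrt3$, and let $\mathbb{T}=\mathbb{R}/2\pi\mathbb{Z}$. For an interval $J\subset[0,\infty)$, a solution on $J$ of the damped Lugiato–Lefever equation $$ i\,\partial_t a = -(i-\zeta)\,a - d\,a_{xx} - (1+i\kappa)|a|^2 a + i f \tag{1}$$ is a complex-valued function $a\in C(J;H^2(\mathbb{T}))\cap C^1(J;L^2(\mathbb{T}))$ that satisfies (1) in $L^2(\mathbb{T})$ for every $t\in J$. For every $\phi\in H^4(\mathbb{T})$ there is a solution $a$ of (1) on $[0,\infty)$ with $a(0)=\phi$. It is unique, in the sense that for every $T>0$ every solution on $[0,T)$ with initial value $\phi$ coincides with $a$ on $[0,T)$. Moreover $a\in C([0,\infty);H^4(\mathbb{T}))$, and there is a constant $c\in\mathbb{C}$ with $\|a(t)-c\|_{H^1(\mathbb{T})}\to 0$ as $t\to\infty$. In particular, every solution $u\in H^2(\mathbb{T})$ of the stationary equation $$ -d\,u''-(i-\zeta)\,u-(1+i\kappa)|u|^2u+i f=0 $$ is constant. -/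

import Mathlib

open MeasureTheory Filter Topology Set
open scoped ENNReal

namespace LLE

/-- The one-dimensional torus of length `2π`. -/
abbrev Torus : Type := AddCircle (2 * Real.pi)

instance : Fact (0 < 2 * Real.pi) := ⟨Real.two_pi_pos⟩

/-- The space `L²(𝕋)` of complex-valued functions, with respect to normalized Lebesgue measure
(this changes the usual norm by the constant factor `√(2π)` only). -/
abbrev L2 : Type := Lp ℂ 2 (AddCircle.haarAddCircle (T := 2 * Real.pi))

/-- The `k`-th Fourier coefficient `(2π)⁻¹ ∫ u(x) e^{-ikx} dx`. -/
noncomputable def coeff (u : L2) (k : ℤ) : ℂ := fourierCoeff (T := 2 * Real.pi) u k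

/-- The `Hˢ(𝕋)` norm `(∑ₖ (1 + k²)ˢ |û(k)|²)^{1/2}`, with the value `∞` off `Hˢ(𝕋)`. -/
noncomputable def sobolevNorm (s : ℕ) (u : L2) : ℝ≥0∞ :=
  (∑' k : ℤ, ENNReal.ofReal ((1 + (k : ℝ) ^ 2) ^ s * ‖coeff u k‖ ^ 2)) ^ (1 / 2 : ℝ)

/-- `u ∈ Hˢ(𝕋)`. -/
def MemH (s : ℕ) (u : L2) : Prop := sobolevNorm s u < ∞

/-- `a ∈ C(J; Hˢ(𝕋))`. -/
def ContinuousInH (s : ℕ) (a : ℝ → L2) (J : Set ℝ) : Prop :=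
  ∀ t ∈ J, MemH s (a t) ∧ Tendsto (fun r => sobolevNorm s (a r - a t)) (𝓝[J] t) (𝓝 0)

/-- `w ∈ L²(𝕋)` is the `n`-th distributional derivative of `u ∈ L²(𝕋)`: by the action on the
exponentials `e^{-ikx}`, this means `ŵ(k) = (ik)ⁿ û(k)` for all `k`. -/
def IsWeakDeriv (n : ℕ) (u w : L2) : Prop :=
  ∀ k : ℤ, coeff w k = (Complex.I * k) ^ n * coeff u k

/-- The right-hand side `-(i - ζ) u - d u_xx - (1 + iκ) |u|² u + i f`, at a point where the
function has the value `u` and its second derivative the value `uxx`. -/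
noncomputable def rhs (d ζ f κ : ℝ) (u uxx : ℂ) : ℂ :=
  -(Complex.I - ζ) * u - d * uxx - (1 + Complex.I * κ) * (‖u‖ : ℂ) ^ 2 * u + Complex.I * f

/-- `a ∈ C(J; H²(𝕋)) ∩ C¹(J; L²(𝕋))` solves
`i ∂ₜa = -(i - ζ) a - d a_xx - (1 + iκ) |a|² a + i f` in `L²(𝕋)` at every time in the
interval `J`. -/
def IsSolutionOn (d ζ f κ : ℝ) (a : ℝ → L2) (J : Set ℝ) : Prop :=
  ContinuousInH 2 a J ∧
  ∃ at' axx : ℝ → L2, ContinuousOn at' J ∧ ∀ t ∈ J,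
    HasDerivWithinAt a (at' t) J t ∧
    IsWeakDeriv 2 (a t) (axx t) ∧
    ∀ᵐ x ∂(AddCircle.haarAddCircle (T := 2 * Real.pi)),
      Complex.I * at' t x = rhs d ζ f κ (a t x) (axx t x)

/-- `u ∈ H²(𝕋)` solves the stationary equation
`-d u'' - (i - ζ) u - (1 + iκ) |u|² u + i f = 0`. -/
def IsStationary (d ζ f κ : ℝ) (u : L2) : Prop :=
  MemH 2 u ∧ ∃ uxx : L2, IsWeakDeriv 2 u uxx ∧
    ∀ᵐ x ∂(AddCircle.haarAddCircle (T := 2 * Real.pi)), rhs d ζ f κ (u x) (uxx x) = 0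

/-- The constant function with value `c`, as an element of `L²(𝕋)`. -/
noncomputable def const (c : ℂ) : L2 :=
  Lp.const 2 (AddCircle.haarAddCircle (T := 2 * Real.pi)) c

end LLE

namespace LLE

/-! ### Fourier coefficients, multipliers and Sobolev norms. -/

section Fourier

/-! For κ ≥ 1/√3 the map u ↦ (i - κ)|u|²u is dissipative on ℂ (`cubic_monotone`, resting on
`cubic_real_inequality`). The dispersive term and the detuning are skew-adjoint, and the damping
contributes -1. Hence two solutions approach each other in L² at rate e^{-t}
(`IsSolutionOn.norm_sub_le`), and everything qualitative follows by choosing what to compare. Two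
solutions with equal data coincide. Two stationary solutions coincide, and since an intermediate
value argument gives a constant one (`exists_equilibrium`), every stationary solution is constant.
Any solution converges in L² to that constant. A solution and its translates are both solutions, so
dividing their distance by the shift shows that the L² norm of the derivative decays like e^{-t}
(`IsSolutionOn.sum_deriv_le`); this upgrades the convergence to H¹.

For existence, H⁴ is identified with L² through (1 - ∂²)⁻², and the unitary group is factored out
(interaction picture). What remains is an ordinary differential equation with a locally Lipschitz
field, because H⁴ is an algebra (`sqNorm_mul_le_mul`). Its solutions are global once they are
bounded on bounded time intervals (`exists_global_solution`). The bound comes from the tame estimate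
`sqNorm_cubic_le`: the cubic term is linear in the H⁴ norm, with a factor depending only on the
Wiener norm. The Wiener norm is controlled by H¹, hence uniformly in time by the contraction, so
Gronwall's inequality applies (`exists_apriori_bound`). -/

lemma coeff_eq_repr (u : L2) (k : ℤ) : coeff u k = fourierBasis.repr u k :=
  (fourierBasis_repr u k).symm

lemma coeff_add (u v : L2) (k : ℤ) : coeff (u + v) k = coeff u k + coeff v k := by
  simp [coeff_eq_repr]

lemma coeff_sub (u v : L2) (k : ℤ) : coeff (u - v) k = coeff u k - coeff v k := by
  simp [coeff_eq_repr]

lemma coeff_smul (c : ℂ) (u : L2) (k : ℤ) : coeff (c • u) k = c * coeff u k := by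
  simp [coeff_eq_repr]

lemma ext_coeff {u v : L2} (h : ∀ k, coeff u k = coeff v k) : u = v := by
  apply fourierBasis.repr.injective
  ext k
  simpa [coeff_eq_repr] using h k

lemma hasSum_norm_coeff_sq (u : L2) : HasSum (fun k => ‖coeff u k‖ ^ 2) (‖u‖ ^ 2) := by
  have h : HasSum (fun k => ‖fourierBasis.repr u k‖ ^ 2) (‖fourierBasis.repr u‖ ^ 2) := by
    apply_mod_cast lp.hasSum_norm ?_ (fourierBasis.repr u)
    simp
  simpa [coeff_eq_repr] using h

lemma hasSum_inner_coeff (u v : L2) :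
    HasSum (fun k => inner ℂ (coeff u k) (coeff v k)) (inner ℂ u v) := by
  have h := lp.hasSum_inner (𝕜 := ℂ) (fourierBasis.repr u) (fourierBasis.repr v)
  simpa [coeff_eq_repr] using h

lemma exists_coeff_eq {c : ℤ → ℂ} (hc : Summable fun k => ‖c k‖ ^ 2) :
    ∃ u : L2, ∀ k, coeff u k = c k := by
  have hm : Memℓp c 2 := by
    apply memℓp_gen
    simpa using hc
  refine ⟨fourierBasis.repr.symm ⟨c, hm⟩, fun k => ?_⟩
  simp [coeff_eq_repr]

lemma norm_coeff_le (u : L2) (k : ℤ) : ‖coeff u k‖ ≤ ‖u‖ := by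
  have h := (hasSum_norm_coeff_sq u).summable.le_tsum k (fun _ _ => by positivity)
  rw [(hasSum_norm_coeff_sq u).tsum_eq] at h
  exact le_of_sq_le_sq h (norm_nonneg _)

lemma norm_le_of_norm_coeff_le {u v : L2} {C : ℝ} (hC : 0 ≤ C)
    (h : ∀ k, ‖coeff u k‖ ≤ C * ‖coeff v k‖) : ‖u‖ ≤ C * ‖v‖ := by
  refine le_of_sq_le_sq ?_ (by positivity)
  rw [mul_pow]
  refine hasSum_le (fun k => ?_) (hasSum_norm_coeff_sq u) ((hasSum_norm_coeff_sq v).mul_left _)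
  rw [← mul_pow]
  gcongr
  exact h k

/-- The Fourier multiplier with bounded symbol `m`. -/
noncomputable def multiplier (m : ℤ → ℂ) (C : ℝ) (hm : ∀ k, ‖m k‖ ≤ C) : L2 →L[ℂ] L2 :=
  have hex : ∀ u : L2, ∃ w : L2, ∀ k, coeff w k = m k * coeff u k := fun u =>
    exists_coeff_eq (.of_nonneg_of_le (fun _ => by positivity)
      (fun k => by
        rw [norm_mul, mul_pow]
        gcongr
        exact hm k) ((hasSum_norm_coeff_sq u).summable.mul_left (C ^ 2)))
  LinearMap.mkContinuous
    { toFun := fun u => (hex u).choose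
      map_add' := fun u v => ext_coeff fun k => by
        rw [(hex (u + v)).choose_spec, coeff_add, coeff_add, (hex u).choose_spec,
          (hex v).choose_spec, mul_add]
      map_smul' := fun c u => ext_coeff fun k => by
        rw [(hex (c • u)).choose_spec, RingHom.id_apply, coeff_smul, coeff_smul,
          (hex u).choose_spec]
        ring }
    C (fun u => norm_le_of_norm_coeff_le ((norm_nonneg _).trans (hm 0)) fun k => by
      simp only [LinearMap.coe_mk, AddHom.coe_mk, (hex _).choose_spec, norm_mul]
      gcongr
      exact hm k)

lemma coeff_multiplier (m : ℤ → ℂ) (C : ℝ) (hm : ∀ k, ‖m k‖ ≤ C) (u : L2) (k : ℤ) :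
    coeff (multiplier m C hm u) k = m k * coeff u k := by
  simp only [multiplier, LinearMap.mkContinuous_apply, LinearMap.coe_mk, AddHom.coe_mk]
  generalize_proofs h
  exact h.choose_spec k

/-- Stated with finite partial sums because the derivative bounds obtained from translations are
proved one finite set of modes at a time. -/
lemma sobolevNorm_le_of_sum_le {s : ℕ} {u : L2} {B : ℝ} (hB : 0 ≤ B)
    (h : ∀ F : Finset ℤ, ∑ k ∈ F, (1 + (k : ℝ) ^ 2) ^ s * ‖coeff u k‖ ^ 2 ≤ B ^ 2) :
    sobolevNorm s u ≤ ENNReal.ofReal B := by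
  have h1 : ∑' k : ℤ, ENNReal.ofReal ((1 + (k : ℝ) ^ 2) ^ s * ‖coeff u k‖ ^ 2)
      ≤ ENNReal.ofReal B ^ (2 : ℝ) := by
    rw [ENNReal.tsum_eq_iSup_sum]
    refine iSup_le fun F => ?_
    rw [← ENNReal.ofReal_sum_of_nonneg (fun _ _ => by positivity),
      ENNReal.ofReal_rpow_of_nonneg hB (by norm_num)]
    apply ENNReal.ofReal_le_ofReal
    exact_mod_cast h F
  unfold sobolevNorm
  calc _ ≤ (ENNReal.ofReal B ^ (2 : ℝ)) ^ (1 / 2 : ℝ) := by gcongr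
    _ = ENNReal.ofReal B := by rw [← ENNReal.rpow_mul]; norm_num

lemma sobolevNorm_le_of_coeff_le {s : ℕ} {u y : L2}
    (h : ∀ k : ℤ, (1 + (k : ℝ) ^ 2) ^ s * ‖coeff u k‖ ^ 2 ≤ ‖coeff y k‖ ^ 2) :
    sobolevNorm s u ≤ ENNReal.ofReal ‖y‖ := by
  refine sobolevNorm_le_of_sum_le (norm_nonneg _) fun F => ?_
  refine (Finset.sum_le_sum fun k _ => h k).trans ?_
  exact sum_le_hasSum F (fun _ _ => by positivity) (hasSum_norm_coeff_sq y)

lemma MemH.summable {s : ℕ} {u : L2} (h : MemH s u) :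
    Summable fun k : ℤ => (1 + (k : ℝ) ^ 2) ^ s * ‖coeff u k‖ ^ 2 := by
  have h1 : ∑' k : ℤ, ENNReal.ofReal ((1 + (k : ℝ) ^ 2) ^ s * ‖coeff u k‖ ^ 2) ≠ ∞ := by
    intro h2
    simp only [MemH, sobolevNorm, h2] at h
    simp at h
  have := ENNReal.summable_toReal h1
  refine this.congr fun k => ?_
  rw [ENNReal.toReal_ofReal (by positivity)]

lemma one_le_weight (k : ℤ) : (1 : ℝ) ≤ 1 + (k : ℝ) ^ 2 := by nlinarith [sq_nonneg (k : ℝ)]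

lemma norm_inv_weight_le (k : ℤ) : ‖((((1 + (k : ℝ) ^ 2) ^ 2)⁻¹ : ℝ) : ℂ)‖ ≤ 1 := by
  rw [Complex.norm_real, Real.norm_of_nonneg (by positivity)]
  exact inv_le_one_of_one_le₀ (one_le_pow₀ (one_le_weight k))

/-- The operator `(1 - ∂²)⁻²`, an isometry of `L²(𝕋)` onto `H⁴(𝕋)`. -/
noncomputable def smoothing : L2 →L[ℂ] L2 := multiplier _ 1 norm_inv_weight_le

lemma coeff_smoothing (u : L2) (k : ℤ) :
    coeff (smoothing u) k = (((1 + (k : ℝ) ^ 2) ^ 2)⁻¹ : ℝ) * coeff u k :=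
  coeff_multiplier _ _ _ _ _

lemma coeff_eq_weight_mul (u : L2) (k : ℤ) :
    coeff u k = (((1 + (k : ℝ) ^ 2) ^ 2 : ℝ) : ℂ) * coeff (smoothing u) k := by
  rw [coeff_smoothing, ← mul_assoc, ← Complex.ofReal_mul, mul_inv_cancel₀ (by positivity)]
  simp

lemma exists_smoothing_eq {φ : L2} (h : MemH 4 φ) : ∃ y : L2, smoothing y = φ := by
  obtain ⟨y, hy⟩ := exists_coeff_eq (c := fun k => (((1 + (k : ℝ) ^ 2) ^ 2 : ℝ) : ℂ) * coeff φ k)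
    (h.summable.congr fun k => by
      rw [norm_mul, Complex.norm_real, Real.norm_of_nonneg (by positivity)]; ring)
  refine ⟨y, ext_coeff fun k => ?_⟩
  rw [coeff_smoothing, hy, ← mul_assoc, ← Complex.ofReal_mul, inv_mul_cancel₀ (by positivity)]
  simp

lemma sobolevNorm_smoothing_le {s : ℕ} (hs : s ≤ 4) (y : L2) :
    sobolevNorm s (smoothing y) ≤ ENNReal.ofReal ‖y‖ := by
  refine sobolevNorm_le_of_coeff_le fun k => ?_
  conv_rhs => rw [coeff_eq_weight_mul y, norm_mul, Complex.norm_real,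
    Real.norm_of_nonneg (by positivity), mul_pow, ← pow_mul]
  gcongr
  exact one_le_weight k

lemma memH_smoothing {s : ℕ} (hs : s ≤ 4) (y : L2) : MemH s (smoothing y) :=
  (sobolevNorm_smoothing_le hs y).trans_lt ENNReal.ofReal_lt_top

end Fourier

/-! ### Convolution inequalities for sums in [0, ∞]. -/

section ENNRealSums

lemma ennreal_mul_le_sq_add_sq (x y : ℝ≥0∞) : x * y ≤ x ^ 2 + y ^ 2 := by
  rcases le_total x y with h | h
  · calc x * y ≤ y * y := by gcongr
      _ = y ^ 2 := (sq y).symm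
      _ ≤ _ := le_add_self
  · calc x * y ≤ x * x := by gcongr
      _ = x ^ 2 := (sq x).symm
      _ ≤ _ := le_self_add

lemma ennreal_add_sq_le (x y : ℝ≥0∞) : (x + y) ^ 2 ≤ 3 * (x ^ 2 + y ^ 2) := by
  calc (x + y) ^ 2 = x ^ 2 + y ^ 2 + 2 * (x * y) := by ring
    _ ≤ x ^ 2 + y ^ 2 + 2 * (x ^ 2 + y ^ 2) := by gcongr; exact ennreal_mul_le_sq_add_sq x y
    _ = _ := by ring

/-- Cauchy–Schwarz with weight α. The factor 2 is lost by expanding the double sum and using xy ≤ x²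
+ y², which avoids subtraction and square roots. -/
lemma ennreal_sq_tsum_mul_le {ι : Type*} (α β : ι → ℝ≥0∞) :
    (∑' i, α i * β i) ^ 2 ≤ 2 * (∑' i, α i) * ∑' i, α i * β i ^ 2 := by
  calc (∑' i, α i * β i) ^ 2 = ∑' i, ∑' j, α i * β i * (α j * β j) := by
        rw [sq, ← ENNReal.tsum_mul_right]
        simp_rw [← ENNReal.tsum_mul_left]
    _ ≤ ∑' i, ∑' j, (α i * β i ^ 2 * α j + α i * (α j * β j ^ 2)) := by
        refine ENNReal.tsum_le_tsum fun i => ENNReal.tsum_le_tsum fun j => ?_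
        calc α i * β i * (α j * β j) = α i * α j * (β i * β j) := by ring
          _ ≤ α i * α j * (β i ^ 2 + β j ^ 2) := by gcongr; exact ennreal_mul_le_sq_add_sq _ _
          _ = _ := by ring
    _ = 2 * (∑' i, α i) * ∑' i, α i * β i ^ 2 := by
        simp_rw [ENNReal.tsum_add, ENNReal.tsum_mul_left, ENNReal.tsum_mul_right]
        ring

lemma ennreal_tsum_conv (α β : ℤ → ℝ≥0∞) :
    ∑' k, ∑' j, α j * β (k - j) = (∑' j, α j) * ∑' j, β j := by
  rw [ENNReal.tsum_comm, ← ENNReal.tsum_mul_right]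
  refine tsum_congr fun j => ?_
  rw [ENNReal.tsum_mul_left]
  congr 1
  exact (Equiv.subRight j).tsum_eq β

lemma ennreal_conv_comm (α β : ℤ → ℝ≥0∞) (k : ℤ) :
    ∑' j, α j * β (k - j) = ∑' j, β j * α (k - j) := by
  rw [← (Equiv.subLeft k).tsum_eq]
  refine tsum_congr fun j => ?_
  simp [mul_comm]

/-- Young's inequality `‖α * β‖₂ ≤ ‖α‖₁ ‖β‖₂`, up to a constant. -/
lemma ennreal_young (α β : ℤ → ℝ≥0∞) :
    ∑' k, (∑' j, α j * β (k - j)) ^ 2 ≤ 2 * (∑' j, α j) ^ 2 * ∑' j, β j ^ 2 := by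
  calc _ ≤ ∑' k, 2 * (∑' i, α i) * ∑' j, α j * β (k - j) ^ 2 :=
        ENNReal.tsum_le_tsum fun k => ennreal_sq_tsum_mul_le _ _
    _ = _ := by
        rw [ENNReal.tsum_mul_left, ennreal_tsum_conv α fun k => β k ^ 2]
        ring

end ENNRealSums

/-! ### Products of continuous functions: Wiener norm and H⁴ norm. -/

section Wiener

/-- The inclusion `C(𝕋) → L²(𝕋)`. -/
noncomputable def incl : C(Torus, ℂ) →L[ℂ] L2 :=
  ContinuousMap.toLp (E := ℂ) 2 (AddCircle.haarAddCircle (T := 2 * Real.pi)) ℂ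

lemma coeFn_incl (f : C(Torus, ℂ)) :
    incl f =ᵐ[AddCircle.haarAddCircle (T := 2 * Real.pi)] f :=
  ContinuousMap.coeFn_toLp _ _

lemma coeff_incl (f : C(Torus, ℂ)) (k : ℤ) : coeff (incl f) k = fourierCoeff f k :=
  fourierCoeff_toLp f k

lemma incl_injective : Function.Injective incl := ContinuousMap.toLp_injective _

lemma coeff_incl_fourier_mul (j : ℤ) (g : C(Torus, ℂ)) (k : ℤ) :
    coeff (incl (fourier j * g)) k = coeff (incl g) (k - j) := by
  rw [coeff_incl, coeff_incl]
  simp only [fourierCoeff]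
  refine integral_congr_ae (Eventually.of_forall fun x => ?_)
  simp only [ContinuousMap.mul_apply, smul_eq_mul]
  rw [show -(k - j) = -k + j by ring, fourier_add, mul_assoc]

lemma coeff_incl_star (f : C(Torus, ℂ)) (k : ℤ) :
    coeff (incl (star f)) k = star (coeff (incl f) (-k)) := by
  rw [coeff_incl, coeff_incl]
  simp only [fourierCoeff]
  refine Eq.trans ?_ (integral_conj (𝕜 := ℂ))
  refine integral_congr_ae (Eventually.of_forall fun x => ?_)
  simp [smul_eq_mul]

/-- The Wiener norm of a continuous function: the sum of the moduli of its Fourier coefficients. -/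
noncomputable def wienerNorm (f : C(Torus, ℂ)) : ℝ≥0∞ := ∑' k, ‖coeff (incl f) k‖ₑ

/-- The weight `(1 + k²)²`. -/
noncomputable def weight (k : ℤ) : ℝ≥0∞ := ENNReal.ofReal ((1 + (k : ℝ) ^ 2) ^ 2)

/-- The square of the `H⁴` norm of a continuous function. -/
noncomputable def sqNorm (f : C(Torus, ℂ)) : ℝ≥0∞ := ∑' k, (weight k * ‖coeff (incl f) k‖ₑ) ^ 2

/-- With A and B the values of 1 + m² at j and k - j, one has 2(A + B) - (1 + k²) = 3 + (k - 2j)² ≥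
0. Squaring and (A + B)² ≤ 2(A² + B²) give the constant 4·2 = 8. -/
lemma weight_le_add (j k : ℤ) : weight k ≤ 8 * (weight j + weight (k - j)) := by
  have h8 : (8 : ℝ≥0∞) = ENNReal.ofReal 8 := by norm_num
  rw [weight, weight, weight, h8, ← ENNReal.ofReal_add (by positivity) (by positivity),
    ← ENNReal.ofReal_mul (by norm_num)]
  apply ENNReal.ofReal_le_ofReal
  push_cast
  have h1 : 1 + (k : ℝ) ^ 2 ≤ 2 * ((1 + (j : ℝ) ^ 2) + (1 + ((k : ℝ) - j) ^ 2)) := by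
    nlinarith [sq_nonneg ((k : ℝ) - 2 * j)]
  calc (1 + (k : ℝ) ^ 2) ^ 2 ≤ (2 * ((1 + (j : ℝ) ^ 2) + (1 + ((k : ℝ) - j) ^ 2))) ^ 2 := by gcongr
    _ ≤ _ := by nlinarith [sq_nonneg ((1 + (j : ℝ) ^ 2) - (1 + ((k : ℝ) - j) ^ 2))]

/-- A finite Wiener norm makes the Fourier series of `f` converge uniformly. Multiplying by `g` and
pairing with the `k`-th exponential are continuous, so the convolution formula holds term by term.
-/
lemma enorm_coeff_mul_le {f : C(Torus, ℂ)} (hf : wienerNorm f ≠ ∞) (g : C(Torus, ℂ)) (k : ℤ) :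
    ‖coeff (incl (f * g)) k‖ₑ ≤ ∑' j, ‖coeff (incl f) j‖ₑ * ‖coeff (incl g) (k - j)‖ₑ := by
  have hs : Summable (fourierCoeff f) := by
    refine Summable.of_norm ((ENNReal.summable_toReal hf).congr fun j => ?_)
    rw [toReal_enorm, coeff_incl]
  have h1 := hasSum_fourier_series_of_summable hs
  let T : C(Torus, ℂ) →L[ℂ] L2 := incl ∘L (ContinuousLinearMap.mul ℂ C(Torus, ℂ)).flip g
  have h2 := (T.hasSum h1)
  have h3 := ((innerSL ℂ (fourierBasis (T := 2 * Real.pi) k)) : L2 →L[ℂ] ℂ).hasSum h2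
  have h4 : ∀ u : L2, innerSL ℂ (fourierBasis (T := 2 * Real.pi) k) u = coeff u k := by
    intro u
    rw [coeff_eq_repr, HilbertBasis.repr_apply_apply]
    rfl
  have h5 : HasSum (fun j => coeff (incl f) j * coeff (incl g) (k - j)) (coeff (incl (f * g)) k) := by
    have h6 : T f = incl (f * g) := rfl
    rw [h4, h6] at h3
    refine Eq.mp (congrArg (HasSum · _) (funext fun j => ?_)) h3
    have h7 : T (fourierCoeff f j • fourier j) = fourierCoeff f j • incl (fourier j * g) := by
      rw [map_smul]
      rfl
    rw [h7, h4, coeff_smul, coeff_incl_fourier_mul,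
      coeff_incl f j]
  rw [← h5.tsum_eq]
  refine enorm_tsum_le_tsum_enorm.trans ?_
  simp_rw [enorm_mul]
  exact le_rfl

lemma wienerNorm_mul_le {f : C(Torus, ℂ)} (hf : wienerNorm f ≠ ∞) (g : C(Torus, ℂ)) :
    wienerNorm (f * g) ≤ wienerNorm f * wienerNorm g := by
  rw [wienerNorm, wienerNorm, wienerNorm, ← ennreal_tsum_conv]
  exact ENNReal.tsum_le_tsum fun k => enorm_coeff_mul_le hf g k

lemma wienerNorm_star (f : C(Torus, ℂ)) : wienerNorm (star f) = wienerNorm f := by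
  rw [wienerNorm, wienerNorm, ← (Equiv.neg ℤ).tsum_eq]
  refine tsum_congr fun k => ?_
  rw [coeff_incl_star]
  simp [enorm_eq_nnnorm]

lemma sqNorm_star (f : C(Torus, ℂ)) : sqNorm (star f) = sqNorm f := by
  rw [sqNorm, sqNorm, ← (Equiv.neg ℤ).tsum_eq]
  refine tsum_congr fun k => ?_
  rw [coeff_incl_star]
  simp [enorm_eq_nnnorm, weight]

lemma sqNorm_add_le (f g : C(Torus, ℂ)) : sqNorm (f + g) ≤ 3 * (sqNorm f + sqNorm g) := by
  rw [sqNorm, sqNorm, sqNorm, ← ENNReal.tsum_add, ← ENNReal.tsum_mul_left]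
  refine ENNReal.tsum_le_tsum fun k => le_trans ?_ (ennreal_add_sq_le _ _)
  rw [map_add, coeff_add, ← mul_add]
  gcongr
  exact enorm_add_le _ _

/-- Tame estimate: the weight of a product falls on one factor at a time, and Young's inequality
puts the other factor in ℓ¹, that is, in the Wiener norm. The constant is 8²·3·2. -/
lemma sqNorm_mul_le {f : C(Torus, ℂ)} (hf : wienerNorm f ≠ ∞) (g : C(Torus, ℂ)) :
    sqNorm (f * g) ≤ 384 * (wienerNorm f ^ 2 * sqNorm g + sqNorm f * wienerNorm g ^ 2) := by
  set α := fun k => ‖coeff (incl f) k‖ₑ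
  set β := fun k => ‖coeff (incl g) k‖ₑ
  have h1 : ∀ k, weight k * ‖coeff (incl (f * g)) k‖ₑ
      ≤ 8 * (∑' j, α j * (weight (k - j) * β (k - j)) + ∑' j, β j * (weight (k - j) * α (k - j))) := by
    intro k
    calc _ ≤ weight k * ∑' j, α j * β (k - j) := by gcongr; exact enorm_coeff_mul_le hf g k
      _ = ∑' j, weight k * (α j * β (k - j)) := ENNReal.tsum_mul_left.symm
      _ ≤ ∑' j, 8 * (α j * (weight (k - j) * β (k - j)) + weight j * α j * β (k - j)) := by
          refine ENNReal.tsum_le_tsum fun j => ?_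
          calc _ ≤ 8 * (weight j + weight (k - j)) * (α j * β (k - j)) := by
                gcongr; exact weight_le_add j k
            _ = _ := by ring
      _ = _ := by
          rw [ENNReal.tsum_mul_left, ENNReal.tsum_add,
            ennreal_conv_comm (fun j => weight j * α j) β]
  calc sqNorm (f * g) ≤ ∑' k, 192 * ((∑' j, α j * (weight (k - j) * β (k - j))) ^ 2
        + (∑' j, β j * (weight (k - j) * α (k - j))) ^ 2) := by
        refine ENNReal.tsum_le_tsum fun k => ?_
        calc _ ≤ (8 * (∑' j, α j * (weight (k - j) * β (k - j))
              + ∑' j, β j * (weight (k - j) * α (k - j)))) ^ 2 := pow_le_pow_left' (h1 k) 2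
          _ = 64 * (∑' j, α j * (weight (k - j) * β (k - j))
              + ∑' j, β j * (weight (k - j) * α (k - j))) ^ 2 := by ring
          _ ≤ 64 * (3 * ((∑' j, α j * (weight (k - j) * β (k - j))) ^ 2
              + (∑' j, β j * (weight (k - j) * α (k - j))) ^ 2)) := by
                gcongr; exact ennreal_add_sq_le _ _
          _ = _ := by ring
    _ = 192 * (∑' k, (∑' j, α j * (weight (k - j) * β (k - j))) ^ 2
        + ∑' k, (∑' j, β j * (weight (k - j) * α (k - j))) ^ 2) := by
        rw [ENNReal.tsum_mul_left, ENNReal.tsum_add]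
    _ ≤ 192 * (2 * wienerNorm f ^ 2 * sqNorm g + 2 * wienerNorm g ^ 2 * sqNorm f) := by
        gcongr
        · exact ennreal_young α fun k => weight k * β k
        · exact ennreal_young β fun k => weight k * α k
    _ = _ := by ring

lemma summable_inv_one_add_sq : Summable fun k : ℤ => (1 + (k : ℝ) ^ 2)⁻¹ := by
  refine Summable.of_norm_bounded_eventually
    (Real.summable_one_div_int_pow.mpr one_lt_two) ?_
  filter_upwards [(Set.finite_singleton (0 : ℤ)).compl_mem_cofinite] with k hk
  have hk' : (k : ℝ) ≠ 0 := by exact_mod_cast hk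
  rw [Real.norm_of_nonneg (by positivity), one_div]
  gcongr
  linarith

/-- The constant in the embedding of `H¹` into the Wiener algebra. -/
noncomputable def embConst : ℝ≥0∞ := 2 * ∑' k : ℤ, ENNReal.ofReal (1 + (k : ℝ) ^ 2)⁻¹

lemma embConst_ne_top : embConst ≠ ∞ := by
  exact ENNReal.mul_ne_top (by simp) summable_inv_one_add_sq.tsum_ofReal_ne_top

/-- Weighted Cauchy–Schwarz with α = (1 + k²)⁻¹, which is summable, and β = (1 + k²)|û(k)|, so that
αβ² is the H¹ density. -/
lemma wienerNorm_sq_le (f : C(Torus, ℂ)) : wienerNorm f ^ 2 ≤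
    embConst * ∑' k : ℤ, ENNReal.ofReal ((1 + (k : ℝ) ^ 2) * ‖coeff (incl f) k‖ ^ 2) := by
  have h1 : wienerNorm f = ∑' k : ℤ, ENNReal.ofReal (1 + (k : ℝ) ^ 2)⁻¹ *
      ENNReal.ofReal ((1 + (k : ℝ) ^ 2) * ‖coeff (incl f) k‖) := by
    refine tsum_congr fun k => ?_
    rw [← ENNReal.ofReal_mul (by positivity), ← ofReal_norm]
    congr 1
    field_simp
  rw [h1]
  refine (ennreal_sq_tsum_mul_le _ _).trans_eq ?_
  rw [embConst]
  congr 1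
  refine tsum_congr fun k => ?_
  rw [← ENNReal.ofReal_pow (by positivity), ← ENNReal.ofReal_mul (by positivity)]
  congr 1
  field_simp

lemma wienerNorm_sq_le_sqNorm (f : C(Torus, ℂ)) : wienerNorm f ^ 2 ≤ embConst * sqNorm f := by
  refine (wienerNorm_sq_le f).trans ?_
  unfold sqNorm
  gcongr with k
  rw [← ofReal_norm, weight, ← ENNReal.ofReal_mul (by positivity),
    ← ENNReal.ofReal_pow (by positivity), mul_pow]
  apply ENNReal.ofReal_le_ofReal
  gcongr
  calc (1 + (k : ℝ) ^ 2) = (1 + (k : ℝ) ^ 2) ^ 1 := (pow_one _).symm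
    _ ≤ (1 + (k : ℝ) ^ 2) ^ 4 := pow_le_pow_right₀ (one_le_weight k) (by norm_num)
    _ = _ := by ring

lemma wienerNorm_ne_top {f : C(Torus, ℂ)} (hf : sqNorm f ≠ ∞) : wienerNorm f ≠ ∞ := by
  intro h
  have := wienerNorm_sq_le_sqNorm f
  rw [h] at this
  simp [ENNReal.mul_eq_top, embConst_ne_top, hf] at this

lemma sqNorm_smoothing {f : C(Torus, ℂ)} {y : L2} (h : smoothing y = incl f) :
    sqNorm f = ENNReal.ofReal (‖y‖ ^ 2) := by
  rw [← (hasSum_norm_coeff_sq y).tsum_eq,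
    ENNReal.ofReal_tsum_of_nonneg (fun _ => by positivity) (hasSum_norm_coeff_sq y).summable]
  refine tsum_congr fun k => ?_
  rw [coeff_eq_weight_mul y, h, norm_mul, Complex.norm_real, Real.norm_of_nonneg (by positivity),
    ENNReal.ofReal_pow (by positivity), ENNReal.ofReal_mul (by positivity), ofReal_norm,
    weight]

lemma exists_smoothing_eq_incl {f : C(Torus, ℂ)} (hf : sqNorm f ≠ ∞) :
    ∃ y, smoothing y = incl f := by
  apply exists_smoothing_eq
  unfold MemH sobolevNorm
  refine ENNReal.rpow_lt_top_of_nonneg (by norm_num) ?_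
  convert hf using 1
  refine tsum_congr fun k => ?_
  rw [← ofReal_norm, weight, ← ENNReal.ofReal_mul (by positivity),
    ← ENNReal.ofReal_pow (by positivity)]
  congr 1
  ring

/-- The coefficients are O((1 + k²)⁻¹), so the Fourier series converges uniformly; its sum is the
continuous representative. -/
lemma exists_incl_eq_smoothing (y : L2) : ∃ f : C(Torus, ℂ), incl f = smoothing y := by
  have hs : Summable fun k => coeff (smoothing y) k • (fourier k : C(Torus, ℂ)) := by
    refine Summable.of_norm_bounded (summable_inv_one_add_sq.mul_right ‖y‖) fun k => ?_
    rw [norm_smul, fourier_norm, mul_one, coeff_smoothing, norm_mul, Complex.norm_real,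
      Real.norm_of_nonneg (by positivity)]
    gcongr
    · exact le_self_pow₀ (one_le_weight k) two_ne_zero
    · exact norm_coeff_le y k
  refine ⟨∑' k, coeff (smoothing y) k • (fourier k : C(Torus, ℂ)), ?_⟩
  have h1 := incl.hasSum hs.hasSum
  refine h1.unique ?_
  convert hasSum_fourier_series_L2 (smoothing y) using 2 with k
  rw [map_smul]
  rfl

end Wiener

/-! ### The cubic nonlinearity on H⁴: Lipschitz and tame bounds. -/

section Nonlinearity

/-- The continuous representative of `(1 - ∂²)⁻² y`. -/
noncomputable def embed (y : L2) : C(Torus, ℂ) := (exists_incl_eq_smoothing y).choose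

lemma incl_embed (y : L2) : incl (embed y) = smoothing y := (exists_incl_eq_smoothing y).choose_spec

lemma embed_sub (y z : L2) : embed (y - z) = embed y - embed z :=
  incl_injective (by simp [incl_embed])

lemma sqNorm_embed (y : L2) : sqNorm (embed y) = ENNReal.ofReal (‖y‖ ^ 2) :=
  sqNorm_smoothing (incl_embed y).symm

lemma sqNorm_embed_ne_top (y : L2) : sqNorm (embed y) ≠ ∞ := by
  rw [sqNorm_embed]; exact ENNReal.ofReal_ne_top

/-- The constant of the Banach algebra `H⁴`. -/
noncomputable def algConst : ℝ≥0∞ := 768 * embConst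

lemma algConst_ne_top : algConst ≠ ∞ := ENNReal.mul_ne_top (by norm_num) embConst_ne_top

lemma sqNorm_mul_le_mul {f : C(Torus, ℂ)} (hf : sqNorm f ≠ ∞) (g : C(Torus, ℂ)) :
    sqNorm (f * g) ≤ algConst * sqNorm f * sqNorm g := by
  calc _ ≤ 384 * (wienerNorm f ^ 2 * sqNorm g + sqNorm f * wienerNorm g ^ 2) :=
        sqNorm_mul_le (wienerNorm_ne_top hf) g
    _ ≤ 384 * ((embConst * sqNorm f) * sqNorm g + sqNorm f * (embConst * sqNorm g)) := by
        gcongr <;> exact wienerNorm_sq_le_sqNorm _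
    _ = _ := by rw [algConst]; ring

lemma sqNorm_mul_ne_top {f g : C(Torus, ℂ)} (hf : sqNorm f ≠ ∞) (hg : sqNorm g ≠ ∞) :
    sqNorm (f * g) ≠ ∞ :=
  ne_top_of_le_ne_top (ENNReal.mul_ne_top (ENNReal.mul_ne_top algConst_ne_top hf) hg)
    (sqNorm_mul_le_mul hf g)

lemma sqNorm_mul_mul_le {f g h : C(Torus, ℂ)} (hf : sqNorm f ≠ ∞) (hg : sqNorm g ≠ ∞) :
    sqNorm (f * g * h) ≤ algConst ^ 2 * (sqNorm f * sqNorm g * sqNorm h) := by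
  calc _ ≤ algConst * sqNorm (f * g) * sqNorm h := sqNorm_mul_le_mul (sqNorm_mul_ne_top hf hg) h
    _ ≤ algConst * (algConst * sqNorm f * sqNorm g) * sqNorm h := by
        gcongr; exact sqNorm_mul_le_mul hf g
    _ = _ := by ring

lemma sqNorm_cubic_sub_le {f g : C(Torus, ℂ)} (hf : sqNorm f ≠ ∞) (hg : sqNorm g ≠ ∞) {M : ℝ≥0∞}
    (hfM : sqNorm f ≤ M) (hgM : sqNorm g ≤ M) (hfg : sqNorm (f - g) ≠ ∞) :
    sqNorm (f * star f * f - g * star g * g) ≤ 27 * algConst ^ 2 * M ^ 2 * sqNorm (f - g) := by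
  -- Telescoping: one of the three factors is exchanged at a time.
  have e : f * star f * f - g * star g * g
      = (f - g) * star f * f + g * star (f - g) * f + g * star g * (f - g) := by
    rw [star_sub]; ring
  rw [e]
  have hf' : sqNorm (star f) ≠ ∞ := by rwa [sqNorm_star]
  have hg' : sqNorm (star g) ≠ ∞ := by rwa [sqNorm_star]
  have hfg' : sqNorm (star (f - g)) ≠ ∞ := by rwa [sqNorm_star]
  set D := sqNorm (f - g) with hD
  have h1 : sqNorm ((f - g) * star f * f) ≤ algConst ^ 2 * (D * M * M) := by
    refine (sqNorm_mul_mul_le hfg hf').trans ?_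
    rw [sqNorm_star]
    gcongr
  have h2 : sqNorm (g * star (f - g) * f) ≤ algConst ^ 2 * (M * D * M) := by
    refine (sqNorm_mul_mul_le hg hfg').trans ?_
    rw [sqNorm_star]
    gcongr
  have h3 : sqNorm (g * star g * (f - g)) ≤ algConst ^ 2 * (M * M * D) := by
    refine (sqNorm_mul_mul_le hg hg').trans ?_
    rw [sqNorm_star]
    gcongr
  calc _ ≤ 3 * (3 * (sqNorm ((f - g) * star f * f) + sqNorm (g * star (f - g) * f))
        + sqNorm (g * star g * (f - g))) := by
        refine (sqNorm_add_le _ _).trans ?_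
        gcongr
        exact sqNorm_add_le _ _
    _ ≤ 3 * (3 * (algConst ^ 2 * (D * M * M) + algConst ^ 2 * (M * D * M))
        + 3 * (algConst ^ 2 * (M * M * D))) := by
        gcongr
        refine h3.trans ?_
        calc _ = 1 * (algConst ^ 2 * (M * M * D)) := (one_mul _).symm
          _ ≤ _ := by gcongr; norm_num
    _ = _ := by ring

/-- The tame estimate applied twice. Linearity in `sqNorm f` is what lets Gronwall's inequality
close; the algebra property alone would give a cubic bound. -/
lemma sqNorm_cubic_le {f : C(Torus, ℂ)} (hf : sqNorm f ≠ ∞) :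
    sqNorm (f * star f * f) ≤ 384 * 769 * wienerNorm f ^ 4 * sqNorm f := by
  have hA := wienerNorm_ne_top hf
  have h1 : wienerNorm (f * star f) ≤ wienerNorm f * wienerNorm f := by
    simpa [wienerNorm_star] using wienerNorm_mul_le hA (star f)
  have h2 : sqNorm (f * star f) ≤ 384 * (wienerNorm f ^ 2 * sqNorm f + sqNorm f * wienerNorm f ^ 2) := by
    simpa [wienerNorm_star, sqNorm_star] using sqNorm_mul_le hA (star f)
  have h3 : wienerNorm (f * star f) ≠ ∞ := ne_top_of_le_ne_top (ENNReal.mul_ne_top hA hA) h1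
  calc _ ≤ 384 * (wienerNorm (f * star f) ^ 2 * sqNorm f
        + sqNorm (f * star f) * wienerNorm f ^ 2) := sqNorm_mul_le h3 f
    _ ≤ 384 * ((wienerNorm f * wienerNorm f) ^ 2 * sqNorm f
        + 384 * (wienerNorm f ^ 2 * sqNorm f + sqNorm f * wienerNorm f ^ 2) * wienerNorm f ^ 2) := by
        gcongr
    _ = _ := by ring

lemma sqNorm_cubic_embed_ne_top (y : L2) :
    sqNorm (embed y * star (embed y) * embed y) ≠ ∞ :=
  sqNorm_mul_ne_top (sqNorm_mul_ne_top (sqNorm_embed_ne_top y)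
    (by rw [sqNorm_star]; exact sqNorm_embed_ne_top y)) (sqNorm_embed_ne_top y)

/-- The map `u ↦ |u|² u` of `H⁴`, transported to `L²` by `smoothing`. -/
noncomputable def nonlin (y : L2) : L2 :=
  (exists_smoothing_eq_incl (sqNorm_cubic_embed_ne_top y)).choose

lemma smoothing_nonlin (y : L2) :
    smoothing (nonlin y) = incl (embed y * star (embed y) * embed y) :=
  (exists_smoothing_eq_incl (sqNorm_cubic_embed_ne_top y)).choose_spec

lemma smoothing_nonlin_ae (y : L2) :
    ∀ᵐ x ∂(AddCircle.haarAddCircle (T := 2 * Real.pi)),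
      smoothing (nonlin y) x = (‖smoothing y x‖ : ℂ) ^ 2 * smoothing y x := by
  rw [smoothing_nonlin, ← incl_embed]
  filter_upwards [coeFn_incl (embed y), coeFn_incl (embed y * star (embed y) * embed y)]
    with x h1 h2
  rw [h1, h2]
  simp only [ContinuousMap.mul_apply, ContinuousMap.star_apply]
  congr 1
  exact Complex.mul_conj' _

/-- The Lipschitz constant of `nonlin` on the unit ball. -/
noncomputable def lipConst : ℝ := Real.sqrt 27 * algConst.toReal

lemma lipConst_nonneg : 0 ≤ lipConst := by unfold lipConst; positivity

lemma norm_nonlin_sub_le {y z : L2} {R : ℝ} (hy : ‖y‖ ≤ R) (hz : ‖z‖ ≤ R) :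
    ‖nonlin y - nonlin z‖ ≤ lipConst * R ^ 2 * ‖y - z‖ := by
  have hR : 0 ≤ R := (norm_nonneg y).trans hy
  have h1 : smoothing (nonlin y - nonlin z) = incl (embed y * star (embed y) * embed y
      - embed z * star (embed z) * embed z) := by
    rw [map_sub, map_sub, smoothing_nonlin, smoothing_nonlin]
  have h2 := sqNorm_cubic_sub_le (M := ENNReal.ofReal (R ^ 2))
    (sqNorm_embed_ne_top y) (sqNorm_embed_ne_top z)
    (by rw [sqNorm_embed]; gcongr) (by rw [sqNorm_embed]; gcongr)
    (by rw [← embed_sub]; exact sqNorm_embed_ne_top _)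
  rw [← embed_sub, sqNorm_embed,
    ← ENNReal.ofReal_toReal algConst_ne_top, show (27 : ℝ≥0∞) = ENNReal.ofReal 27 by norm_num,
    ← ENNReal.ofReal_pow (by positivity), ← ENNReal.ofReal_pow (by positivity),
    ← ENNReal.ofReal_mul (by positivity), ← ENNReal.ofReal_mul (by positivity),
    ← ENNReal.ofReal_mul (by positivity), sqNorm_smoothing h1,
    ENNReal.ofReal_le_ofReal_iff (by positivity)] at h2
  refine le_of_sq_le_sq (h2.trans_eq ?_) (by unfold lipConst; positivity)
  rw [lipConst]
  ring_nf
  rw [Real.sq_sqrt (by norm_num)]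

/-- Square root of the tame cubic bound, with 384·769 rounded up to 768². -/
lemma norm_nonlin_le_of_wienerNorm_le {y : L2} {B : ℝ} (hB : 0 ≤ B)
    (h : wienerNorm (embed y) ^ 2 ≤ ENNReal.ofReal B) : ‖nonlin y‖ ≤ 768 * B * ‖y‖ := by
  have h2 := sqNorm_cubic_le (sqNorm_embed_ne_top y)
  have h3 : sqNorm (embed y * star (embed y) * embed y)
      ≤ 384 * 769 * ENNReal.ofReal B ^ 2 * sqNorm (embed y) := by
    refine h2.trans ?_
    rw [show wienerNorm (embed y) ^ 4 = (wienerNorm (embed y) ^ 2) ^ 2 by ring]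
    gcongr
  rw [sqNorm_smoothing (smoothing_nonlin y), sqNorm_embed,
    show (384 * 769 : ℝ≥0∞) = ENNReal.ofReal (384 * 769) by
      rw [ENNReal.ofReal_mul (by norm_num)]; norm_num,
    ← ENNReal.ofReal_pow (by positivity),
    ← ENNReal.ofReal_mul (by positivity), ← ENNReal.ofReal_mul (by positivity),
    ENNReal.ofReal_le_ofReal_iff (by positivity)] at h3
  refine le_of_sq_le_sq (h3.trans ?_) (by positivity)
  rw [mul_pow, mul_pow]
  gcongr
  norm_num

lemma continuous_nonlin : Continuous nonlin := by
  refine continuous_iff_continuousAt.mpr fun y => ?_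
  refine LipschitzOnWith.continuousOn (s := Metric.ball 0 (‖y‖ + 1))
    (K := (lipConst * (‖y‖ + 1) ^ 2).toNNReal) ?_ |>.continuousAt
      (Metric.isOpen_ball.mem_nhds (by simp))
  refine LipschitzOnWith.of_dist_le_mul fun z hz w hw => ?_
  rw [dist_eq_norm, dist_eq_norm, Real.coe_toNNReal _ (by have := lipConst_nonneg; positivity)]
  exact norm_nonlin_sub_le (by simpa using (mem_ball_zero_iff.mp hz).le)
    (by simpa using (mem_ball_zero_iff.mp hw).le)

end Nonlinearity

/-! ### Constant functions. -/

section Constants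

lemma const_eq_incl (c : ℂ) : const c = incl (ContinuousMap.const _ c) := by
  refine Lp.ext ?_
  filter_upwards [Lp.coeFn_const (p := 2) (μ := AddCircle.haarAddCircle (T := 2 * Real.pi)) c,
    coeFn_incl (ContinuousMap.const _ c)] with x h1 h2
  rw [h2]
  exact h1

lemma const_ae (c : ℂ) : const c =ᵐ[AddCircle.haarAddCircle (T := 2 * Real.pi)] fun _ => c :=
  Lp.coeFn_const (p := 2) (μ := AddCircle.haarAddCircle (T := 2 * Real.pi)) c

lemma coeff_const (c : ℂ) (k : ℤ) : coeff (const c) k = if k = 0 then c else 0 := by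
  have h : const c = c • incl (fourier 0) := by
    rw [const_eq_incl, ← map_smul]
    congr 1
    ext x
    simp
  rw [h, coeff_smul, coeff_incl, fourierCoeff_fourier, Pi.single_apply]
  simp

lemma smoothing_const (c : ℂ) : smoothing (const c) = const c := by
  refine ext_coeff fun k => ?_
  rw [coeff_smoothing, coeff_const]
  split_ifs with h <;> simp [h]

end Constants

/-! ### The unitary group and its differentiability after smoothing. -/

section Propagator

/-- The symbol of the propagator. -/
noncomputable def phase (d ζ t : ℝ) (k : ℤ) : ℂ :=
  Complex.exp (Complex.I * ((-(ζ + d * (k : ℝ) ^ 2) * t : ℝ) : ℂ))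

lemma norm_phase (d ζ t : ℝ) (k : ℤ) : ‖phase d ζ t k‖ = 1 := by
  rw [phase, mul_comm, Complex.norm_exp_ofReal_mul_I]

/-- The unitary group generated by `-iζ + i d ∂²`. -/
noncomputable def propagator (d ζ t : ℝ) : L2 →L[ℂ] L2 :=
  multiplier (phase d ζ t) 1 fun k => (norm_phase d ζ t k).le

lemma coeff_propagator (d ζ t : ℝ) (u : L2) (k : ℤ) :
    coeff (propagator d ζ t u) k = phase d ζ t k * coeff u k :=
  coeff_multiplier _ _ _ _ _

lemma norm_propagator (d ζ t : ℝ) (u : L2) : ‖propagator d ζ t u‖ = ‖u‖ := by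
  apply le_antisymm
  · simpa using norm_le_of_norm_coeff_le (u := propagator d ζ t u) (v := u) zero_le_one fun k => by
      simp [coeff_propagator, norm_phase]
  · simpa using norm_le_of_norm_coeff_le (v := propagator d ζ t u) (u := u) zero_le_one fun k => by
      simp [coeff_propagator, norm_phase]

lemma propagator_neg_apply (d ζ t : ℝ) (u : L2) : propagator d ζ t (propagator d ζ (-t) u) = u := by
  refine ext_coeff fun k => ?_
  rw [coeff_propagator, coeff_propagator, ← mul_assoc, phase, phase, ← Complex.exp_add]
  rw [← mul_add, ← Complex.ofReal_add]
  simp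

lemma propagator_zero (d ζ : ℝ) (u : L2) : propagator d ζ 0 u = u := by
  refine ext_coeff fun k => ?_
  simp [coeff_propagator, phase]

/-- Strong continuity by dominated convergence over the modes: each phase is continuous in time, and
differences of phases have modulus at most 2. -/
lemma continuous_propagator_apply (d ζ : ℝ) (u : L2) :
    Continuous fun t => propagator d ζ t u := by
  refine continuous_iff_continuousAt.mpr fun t => ?_
  rw [ContinuousAt, tendsto_iff_norm_sub_tendsto_zero]
  have h1 : ∀ s, ‖propagator d ζ s u - propagator d ζ t u‖ ^ 2
      = ∑' k, ‖phase d ζ s k - phase d ζ t k‖ ^ 2 * ‖coeff u k‖ ^ 2 := by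
    intro s
    rw [← (hasSum_norm_coeff_sq _).tsum_eq]
    refine tsum_congr fun k => ?_
    rw [coeff_sub, coeff_propagator, coeff_propagator, ← sub_mul, norm_mul, mul_pow]
  have h2 : Tendsto (fun s => ∑' k, ‖phase d ζ s k - phase d ζ t k‖ ^ 2 * ‖coeff u k‖ ^ 2) (𝓝 t)
      (𝓝 (∑' _ : ℤ, 0)) := by
    refine tendsto_tsum_of_dominated_convergence (bound := fun k => 4 * ‖coeff u k‖ ^ 2)
      ((hasSum_norm_coeff_sq u).summable.mul_left 4) (fun k => ?_)
      (Eventually.of_forall fun s k => ?_)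
    · have : Continuous fun s => ‖phase d ζ s k - phase d ζ t k‖ ^ 2 * ‖coeff u k‖ ^ 2 := by
        unfold phase; fun_prop
      simpa using this.tendsto t
    · rw [Real.norm_of_nonneg (by positivity)]
      gcongr
      calc _ ≤ (‖phase d ζ s k‖ + ‖phase d ζ t k‖) ^ 2 := by gcongr; exact norm_sub_le _ _
        _ = 4 := by rw [norm_phase, norm_phase]; norm_num
  simp_rw [← h1] at h2
  simpa using h2.sqrt

lemma continuous_propagator (d ζ : ℝ) : Continuous fun p : ℝ × L2 => propagator d ζ p.1 p.2 := by
  refine continuous_iff_continuousAt.mpr fun ⟨t, u⟩ => ?_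
  rw [ContinuousAt, tendsto_iff_norm_sub_tendsto_zero]
  have h1 : Continuous fun p : ℝ × L2 =>
      ‖p.2 - u‖ + ‖propagator d ζ p.1 u - propagator d ζ t u‖ := by
    have := (continuous_propagator_apply d ζ u).comp (continuous_fst (X := ℝ) (Y := L2))
    simp only [Function.comp_def] at this
    fun_prop
  refine squeeze_zero (fun _ => norm_nonneg _) (fun p => ?_) (by simpa using h1.tendsto (t, u))
  calc _ = ‖propagator d ζ p.1 (p.2 - u) + (propagator d ζ p.1 u - propagator d ζ t u)‖ := by
        rw [map_sub]; congr 1; abel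
    _ ≤ _ := by
        refine (norm_add_le _ _).trans ?_
        rw [norm_propagator]

lemma norm_secondDeriv_symbol_le (k : ℤ) :
    ‖(Complex.I * k) ^ 2 * ((((1 + (k : ℝ) ^ 2) ^ 2)⁻¹ : ℝ) : ℂ)‖ ≤ 1 := by
  rw [norm_mul, norm_pow, norm_mul, Complex.norm_I, one_mul, Complex.norm_intCast,
    Complex.norm_real, Real.norm_of_nonneg (by positivity), sq_abs, ← div_eq_mul_inv,
    div_le_one (by positivity)]
  nlinarith [sq_nonneg ((k : ℝ)), sq_nonneg ((k : ℝ) ^ 2)]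

/-- The operator `∂² (1 - ∂²)⁻²`. -/
noncomputable def smoothingDeriv : L2 →L[ℂ] L2 := multiplier _ 1 norm_secondDeriv_symbol_le

lemma coeff_smoothingDeriv (u : L2) (k : ℤ) :
    coeff (smoothingDeriv u) k = (Complex.I * k) ^ 2 * coeff (smoothing u) k := by
  rw [coeff_smoothing, ← mul_assoc]
  exact coeff_multiplier _ _ _ _ _

/-- Needed for all real `x`, since the frequencies are unbounded. For |x| ≥ 1 the left side is at
most 2|x| ≤ 2x². -/
lemma norm_exp_I_mul_sub_le (x : ℝ) :
    ‖Complex.exp (Complex.I * x) - 1 - Complex.I * x‖ ≤ 3 * x ^ 2 := by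
  rcases le_total |x| 1 with h | h
  · have h1 := Complex.norm_exp_sub_one_sub_id_le (x := Complex.I * x) (by simpa using h)
    simp only [norm_mul, Complex.norm_I, one_mul, Complex.norm_real, Real.norm_eq_abs, sq_abs] at h1
    nlinarith [sq_nonneg x]
  · have h1 := Real.norm_exp_I_mul_ofReal_sub_one_le (x := x)
    have h2 : ‖Complex.I * (x : ℂ)‖ = |x| := by simp
    have h3 := norm_sub_le (Complex.exp (Complex.I * x) - 1) (Complex.I * x)
    rw [Real.norm_eq_abs] at h1
    nlinarith [sq_abs x]

/-- The second-order Taylor error of a phase is O(l²(s - t)²) with |l| ≤ C(1 + k²), and the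
smoothing factor (1 + k²)⁻² absorbs l² exactly. The derivative therefore exists in operator norm, so
that the product rule applies to a moving argument. -/
lemma hasDerivAt_smoothing_propagator (d ζ t : ℝ) :
    HasDerivAt (fun s => (smoothing ∘L propagator d ζ s).restrictScalars ℝ)
      (((((-Complex.I * ζ) • smoothing + (Complex.I * d) • smoothingDeriv) ∘L
        propagator d ζ t)).restrictScalars ℝ) t := by
  rw [hasDerivAt_iff_isLittleO]
  refine Asymptotics.IsBigO.trans_isLittleO (g := fun s => ‖s - t‖ ^ 2) ?_
    (Asymptotics.isLittleO_pow_sub_sub t one_lt_two)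
  refine Asymptotics.IsBigO.of_bound (3 * (|ζ| + |d|) ^ 2) (Eventually.of_forall fun s => ?_)
  rw [norm_pow, norm_norm]
  refine ContinuousLinearMap.opNorm_le_bound _ (by positivity) fun u => ?_
  refine norm_le_of_norm_coeff_le (by positivity) fun k => ?_
  set l : ℝ := -(ζ + d * (k : ℝ) ^ 2) with hl
  have h1 : phase d ζ s k = phase d ζ t k * Complex.exp (Complex.I * ((l * (s - t) : ℝ) : ℂ)) := by
    rw [phase, phase, ← Complex.exp_add, ← hl]
    congr 1
    push_cast
    ring
  have h2 : coeff ((((smoothing ∘L propagator d ζ s).restrictScalars ℝ)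
      - ((smoothing ∘L propagator d ζ t).restrictScalars ℝ)
      - (s - t) • (((((-Complex.I * ζ) • smoothing + (Complex.I * d) • smoothingDeriv) ∘L
        propagator d ζ t)).restrictScalars ℝ)) u) k
      = ((((1 + (k : ℝ) ^ 2) ^ 2)⁻¹ : ℝ) : ℂ) * phase d ζ t k *
        (Complex.exp (Complex.I * ((l * (s - t) : ℝ) : ℂ)) - 1 - Complex.I * ((l * (s - t) : ℝ) : ℂ))
        * coeff u k := by
    have h3 : ∀ w : L2, coeff ((s - t) • w) k = ((s - t : ℝ) : ℂ) * coeff w k := by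
      intro w
      rw [← coeff_smul]
      congr 1
    simp only [sub_apply, smul_apply,
      ContinuousLinearMap.coe_restrictScalars', ContinuousLinearMap.comp_apply,
      add_apply, coeff_sub, h3, coeff_add, coeff_smul, coeff_smoothingDeriv,
      coeff_smoothing, coeff_propagator, h1, hl, mul_pow, Complex.I_sq]
    push_cast
    ring
  rw [h2, norm_mul, norm_mul, norm_mul, norm_phase, mul_one]
  refine mul_le_mul_of_nonneg_right ?_ (norm_nonneg _)
  rw [Complex.norm_real, Real.norm_of_nonneg (by positivity)]
  have h4 : |l| ≤ (|ζ| + |d|) * (1 + (k : ℝ) ^ 2) := by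
    rw [hl, abs_neg]
    calc _ ≤ |ζ| + |d * (k : ℝ) ^ 2| := abs_add_le _ _
      _ = |ζ| + |d| * (k : ℝ) ^ 2 := by rw [abs_mul, abs_of_nonneg (sq_nonneg (k : ℝ))]
      _ ≤ _ := by nlinarith [abs_nonneg ζ, abs_nonneg d, sq_nonneg (k : ℝ)]
  calc _ ≤ ((1 + (k : ℝ) ^ 2) ^ 2)⁻¹ * (3 * (l * (s - t)) ^ 2) := by
        gcongr; exact norm_exp_I_mul_sub_le _
    _ = ((1 + (k : ℝ) ^ 2) ^ 2)⁻¹ * (3 * (|l| ^ 2 * (s - t) ^ 2)) := by rw [sq_abs]; ring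
    _ ≤ ((1 + (k : ℝ) ^ 2) ^ 2)⁻¹ *
        (3 * (((|ζ| + |d|) * (1 + (k : ℝ) ^ 2)) ^ 2 * (s - t) ^ 2)) := by gcongr
    _ = _ := by
        rw [Real.norm_eq_abs, sq_abs]
        field_simp

end Propagator

/-! ### Dissipativity of the equation in L². -/

section Monotone

/-- It suffices that 3((s - t)y)² ≤ P². After substituting y² = st - x², the difference is a
quadratic in `x`, nonnegative by completing the square. -/
lemma cubic_real_inequality {s t x y κ : ℝ} (hs : 0 ≤ s) (ht : 0 ≤ t) (hxy : x ^ 2 + y ^ 2 = s * t)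
    (hκ0 : 0 < κ) (hκ : 1 ≤ 3 * κ ^ 2) :
    (s - t) * y ≤ κ * (s ^ 2 + t ^ 2 - (s + t) * x) := by
  set P := s ^ 2 + t ^ 2 - (s + t) * x with hP
  have hP0 : 0 ≤ P := by
    have h1 : (2 * x) ^ 2 ≤ (s + t) ^ 2 := by nlinarith [sq_nonneg (s - t), sq_nonneg y]
    have h2 : 2 * x ≤ s + t := le_of_sq_le_sq h1 (by positivity)
    nlinarith [mul_le_mul_of_nonneg_left h2 (add_nonneg hs ht), sq_nonneg (s - t)]
  have h3 : 3 * ((s - t) * y) ^ 2 ≤ P ^ 2 := by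
    -- `A` is the leading coefficient (s + t)² + 3(s - t)² of that quadratic; the remainder of the
    -- completed square is 3(s - t)⁶.
    set A := 4 * (s ^ 2 + t ^ 2) - 4 * (s * t) with hA
    have hA0 : 0 ≤ A := by nlinarith [sq_nonneg (s - t), sq_nonneg (s + t), mul_nonneg hs ht]
    have key : A * (P ^ 2 - 3 * ((s - t) * y) ^ 2)
        = (A * x - (s + t) * (s ^ 2 + t ^ 2)) ^ 2 + 3 * ((s - t) ^ 2) ^ 3 := by
      have hy : y ^ 2 = s * t - x ^ 2 := by linarith
      rw [mul_pow, hy, hP, hA]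
      ring
    have h4 : 0 ≤ A * (P ^ 2 - 3 * ((s - t) * y) ^ 2) := by rw [key]; positivity
    rcases hA0.lt_or_eq with h | h
    · nlinarith [nonneg_of_mul_nonneg_right h4 h]
    · have : (s - t) ^ 2 = 0 := by nlinarith [sq_nonneg (s - t), sq_nonneg (s + t), mul_nonneg hs ht]
      rw [mul_pow, this]
      nlinarith [sq_nonneg P]
  refine le_of_sq_le_sq ?_ (by positivity)
  rw [mul_pow]
  nlinarith [sq_nonneg P, sq_nonneg ((s - t) * y)]

/-- Put s = |a|², t = |b|², x + iy = a·b̄. Then (|a|²a - |b|²b) times the conjugate of a - b equals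
P - i(s - t)y with P = s² + t² - (s + t)x, and the real part after multiplication by i - κ is (s -
t)y - κP. -/
lemma cubic_monotone {κ : ℝ} (hκ0 : 0 < κ) (hκ : 1 ≤ 3 * κ ^ 2) (a b : ℂ) :
    ((Complex.I - κ) * ((‖a‖ : ℂ) ^ 2 * a - (‖b‖ : ℂ) ^ 2 * b) * star (a - b)).re ≤ 0 := by
  have h := cubic_real_inequality (s := ‖a‖ ^ 2) (t := ‖b‖ ^ 2)
    (x := a.re * b.re + a.im * b.im) (y := a.im * b.re - a.re * b.im)
    (by positivity) (by positivity) (by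
      rw [← Complex.normSq_eq_norm_sq, ← Complex.normSq_eq_norm_sq, Complex.normSq_apply,
        Complex.normSq_apply]
      ring) hκ0 hκ
  have ha : ((‖a‖ : ℂ)) ^ 2 = ((a.re ^ 2 + a.im ^ 2 : ℝ) : ℂ) := by
    rw [← Complex.ofReal_pow, ← Complex.normSq_eq_norm_sq, Complex.normSq_apply]
    ring_nf
  have hb : ((‖b‖ : ℂ)) ^ 2 = ((b.re ^ 2 + b.im ^ 2 : ℝ) : ℂ) := by
    rw [← Complex.ofReal_pow, ← Complex.normSq_eq_norm_sq, Complex.normSq_apply]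
    ring_nf
  rw [← Complex.normSq_eq_norm_sq, ← Complex.normSq_eq_norm_sq, Complex.normSq_apply,
        Complex.normSq_apply] at h
  rw [ha, hb]
  simp only [Complex.mul_re, Complex.mul_im, Complex.sub_re, Complex.sub_im, Complex.I_re,
    Complex.I_im, Complex.ofReal_re, Complex.ofReal_im, star_sub, Complex.star_def,
    Complex.conj_re, Complex.conj_im]
  nlinarith [h]

/-- `κ ≥ 1/√3`, in the form in which it is used. -/
lemma pos_and_one_le_of_inv_sqrt_three_le {κ : ℝ} (hκ : 1 / Real.sqrt 3 ≤ κ) : 0 < κ ∧ 1 ≤ 3 * κ ^ 2 := by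
  have h3 : 0 < Real.sqrt 3 := by positivity
  have h0 : 0 < κ := lt_of_lt_of_le (by positivity) hκ
  refine ⟨h0, ?_⟩
  rw [div_le_iff₀ h3] at hκ
  nlinarith [Real.sq_sqrt (show (0 : ℝ) ≤ 3 by norm_num)]

/-- The operator id∂² is skew-adjoint: mode by mode, the inner product is purely imaginary. -/
lemma re_inner_secondDeriv_eq_zero (d : ℝ) {w wxx : L2} (h : IsWeakDeriv 2 w wxx) :
    (inner ℂ w ((Complex.I * d) • wxx)).re = 0 := by
  have h1 := Complex.hasSum_re (hasSum_inner_coeff w ((Complex.I * d) • wxx))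
  refine h1.unique ?_
  convert hasSum_zero using 2 with k
  rw [coeff_smul, h k]
  simp only [RCLike.inner_apply, mul_pow, Complex.I_sq]
  have e : Complex.I * d * (-1 * (k : ℂ) ^ 2 * coeff w k) * (starRingEnd ℂ) (coeff w k)
      = ((-(d * (k : ℝ) ^ 2 * ‖coeff w k‖ ^ 2) : ℝ) : ℂ) * Complex.I := by
    push_cast
    rw [← Complex.mul_conj']
    ring
  rw [e, Complex.re_ofReal_mul]
  simp

/-- Dissipativity of the right-hand side of the equation. -/
lemma re_inner_sub_le {d ζ f κ : ℝ} (hκ : 1 / Real.sqrt 3 ≤ κ) {a b at' bt' axx bxx : L2}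
    (ha : IsWeakDeriv 2 a axx) (hb : IsWeakDeriv 2 b bxx)
    (hat : ∀ᵐ x ∂(AddCircle.haarAddCircle (T := 2 * Real.pi)),
      Complex.I * at' x = rhs d ζ f κ (a x) (axx x))
    (hbt : ∀ᵐ x ∂(AddCircle.haarAddCircle (T := 2 * Real.pi)),
      Complex.I * bt' x = rhs d ζ f κ (b x) (bxx x)) :
    (inner ℂ (a - b) (at' - bt')).re ≤ -‖a - b‖ ^ 2 := by
  obtain ⟨hκ0, hκ1⟩ := pos_and_one_le_of_inv_sqrt_three_le hκ
  have hw : IsWeakDeriv 2 (a - b) (axx - bxx) := fun k => by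
    rw [coeff_sub, coeff_sub, ha k, hb k, mul_sub]
  -- The dispersive term vanishes on the Fourier side; the remainder `p` contains no derivatives and
  -- is estimated pointwise under the integral.
  set p := (at' - bt') - (Complex.I * d) • (axx - bxx) with hp
  have e : at' - bt' = p + (Complex.I * d) • (axx - bxx) := by rw [hp]; abel
  rw [e, inner_add_right, Complex.add_re, re_inner_secondDeriv_eq_zero d hw, add_zero]
  have hsq : ‖a - b‖ ^ 2 = ∫ x, ‖(a - b) x‖ ^ 2 ∂(AddCircle.haarAddCircle (T := 2 * Real.pi)) := by
    rw [← (hasSum_norm_coeff_sq (a - b)).tsum_eq]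
    exact tsum_sq_fourierCoeff _
  have hint : Integrable (fun x => ‖(a - b) x‖ ^ 2)
      (AddCircle.haarAddCircle (T := 2 * Real.pi)) :=
    (memLp_two_iff_integrable_sq_norm (Lp.aestronglyMeasurable _)).mp (Lp.memLp (a - b))
  rw [L2.inner_def, hsq, ← integral_neg]
  have hre := integral_re (L2.integrable_inner (𝕜 := ℂ) (a - b) p)
  simp only [RCLike.re_to_complex] at hre
  rw [← hre]
  refine integral_mono_ae ((L2.integrable_inner (𝕜 := ℂ) (a - b) p).re) hint.neg ?_
  filter_upwards [hat, hbt, Lp.coeFn_sub a b, Lp.coeFn_sub at' bt', Lp.coeFn_sub axx bxx,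
    Lp.coeFn_sub (at' - bt') ((Complex.I * d) • (axx - bxx)),
    Lp.coeFn_smul (Complex.I * (d : ℂ)) (axx - bxx)] with x h1 h2 h3 h4 h5 h6 h7
  have h8 : p x = -(1 + Complex.I * ζ) * (a x - b x)
      + (Complex.I - κ) * ((‖a x‖ : ℂ) ^ 2 * a x - (‖b x‖ : ℂ) ^ 2 * b x) := by
    rw [hp, h6, Pi.sub_apply, h4, h7, Pi.smul_apply, h5, Pi.sub_apply, Pi.sub_apply, smul_eq_mul]
    simp only [rhs] at h1 h2
    have h1' : at' x = -Complex.I * (Complex.I * at' x) := by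
      rw [← mul_assoc]; simp
    have h2' : bt' x = -Complex.I * (Complex.I * bt' x) := by
      rw [← mul_assoc]; simp
    rw [h1', h2', h1, h2]
    linear_combination ((a x - b x) + κ * ((‖a x‖ : ℂ) ^ 2 * a x - (‖b x‖ : ℂ) ^ 2 * b x))
      * Complex.I_sq
  have h9 := cubic_monotone hκ0 hκ1 (a x) (b x)
  simp only [h3, Pi.sub_apply, h8, RCLike.inner_apply]
  rw [add_mul, Complex.add_re]
  have h10 : (-(1 + Complex.I * ζ) * (a x - b x) * (starRingEnd ℂ) (a x - b x)).re
      = -‖a x - b x‖ ^ 2 := by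
    rw [mul_assoc, Complex.mul_conj', ← Complex.ofReal_pow, Complex.re_mul_ofReal]
    simp
  rw [h10]
  have : ((Complex.I - κ) * ((‖a x‖ : ℂ) ^ 2 * a x - (‖b x‖ : ℂ) ^ 2 * b x)
      * (starRingEnd ℂ) (a x - b x)).re ≤ 0 := h9
  linarith

end Monotone

/-! ### Contraction of the flow, and decay of the derivative by translation. -/

section Contraction

lemma real_inner_eq_re (u v : L2) : inner ℝ u v = (inner ℂ u v).re := by
  rw [L2.inner_def, L2.inner_def]
  exact integral_re (L2.integrable_inner (𝕜 := ℂ) u v)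

/-- The flow contracts the `L²` distance. -/
lemma IsSolutionOn.norm_sub_le {d ζ f κ : ℝ} (hκ : 1 / Real.sqrt 3 ≤ κ) {J : Set ℝ}
    (hJ : Convex ℝ J) {a b : ℝ → L2} (ha : IsSolutionOn d ζ f κ a J)
    (hb : IsSolutionOn d ζ f κ b J) {s t : ℝ} (hs : s ∈ J) (ht : t ∈ J) (hst : s ≤ t) :
    ‖a t - b t‖ ≤ Real.exp (-(t - s)) * ‖a s - b s‖ := by
  obtain ⟨-, at', axx, -, ha⟩ := ha
  obtain ⟨-, bt', bxx, -, hb⟩ := hb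
  -- Integrating factor: dissipativity says exactly that `g` is nonincreasing.
  let g : ℝ → ℝ := fun r => Real.exp (2 * r) * ‖a r - b r‖ ^ 2
  have hg : ∀ r ∈ J, HasDerivWithinAt g (Real.exp (2 * r) * (2 * (‖a r - b r‖ ^ 2
      + (inner ℂ (a r - b r) (at' r - bt' r)).re))) J r := by
    intro r hr
    have h1 : HasDerivWithinAt (fun r => a r - b r) (at' r - bt' r) J r :=
      (ha r hr).1.sub (hb r hr).1
    have h2 := h1.norm_sq
    have h3 : HasDerivWithinAt (fun r : ℝ => Real.exp (2 * r)) (Real.exp (2 * r) * 2) J r := by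
      simpa using (((hasDerivAt_id r).const_mul 2).exp).hasDerivWithinAt
    rw [real_inner_eq_re] at h2
    refine (h3.mul h2).congr_deriv ?_
    ring
  have hanti : AntitoneOn g J := by
    refine antitoneOn_of_hasDerivWithinAt_nonpos hJ (fun r hr => (hg r hr).continuousWithinAt)
      (fun r hr => (hg r (interior_subset hr)).mono interior_subset) fun r hr => ?_
    have hr' := interior_subset hr
    have := re_inner_sub_le hκ (ha r hr').2.1 (hb r hr').2.1 (ha r hr').2.2 (hb r hr').2.2
    have h5 := Real.exp_pos (2 * r)
    nlinarith
  have h6 := hanti hs ht hst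
  refine le_of_sq_le_sq ?_ (by positivity)
  have h7 : Real.exp (-(t - s)) ^ 2 = Real.exp (2 * s) / Real.exp (2 * t) := by
    rw [← Real.exp_nat_mul, ← Real.exp_sub]
    congr 1
    push_cast
    ring
  rw [mul_pow, h7, div_mul_eq_mul_div, le_div_iff₀ (Real.exp_pos _), mul_comm]
  exact h6

lemma measurePreserving_add_torus (h : Torus) :
    MeasurePreserving (fun x : Torus => x + h) (AddCircle.haarAddCircle (T := 2 * Real.pi))
      (AddCircle.haarAddCircle (T := 2 * Real.pi)) :=
  measurePreserving_add_right _ h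

/-- Translation of functions on the torus. -/
noncomputable def translate (h : Torus) : L2 →L[ℝ] L2 :=
  (Lp.compMeasurePreservingₗᵢ ℝ _ (measurePreserving_add_torus h)).toContinuousLinearMap

lemma translate_ae (h : Torus) (u : L2) :
    translate h u =ᵐ[AddCircle.haarAddCircle (T := 2 * Real.pi)] fun x => u (x + h) :=
  Lp.coeFn_compMeasurePreserving u (measurePreserving_add_torus h)

lemma coeff_translate (h : Torus) (u : L2) (k : ℤ) :
    coeff (translate h u) k = fourier k h * coeff u k := by
  have h1 : coeff (translate h u) k = ∫ x, fourier (-k) x • u (x + h)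
      ∂(AddCircle.haarAddCircle (T := 2 * Real.pi)) := by
    refine integral_congr_ae ?_
    filter_upwards [translate_ae h u] with x hx
    rw [hx]
  have h2 : ∀ x : Torus, fourier (-k) x • u (x + h)
      = fourier k h * (fourier (-k) (x + h) • u (x + h)) := by
    intro x
    have h3 : fourier k h * fourier (-k) (x + h) = (fourier (-k) x : ℂ) := by
      have h4 : ∀ j : ℤ, fourier j (x + h) = (fourier j x * fourier j h : ℂ) := fun j => by
        simp only [fourier_apply, smul_add, AddCircle.toCircle_add, Circle.coe_mul]
      rw [h4, mul_left_comm, ← fourier_add, add_neg_cancel, fourier_zero, mul_one]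
    rw [smul_eq_mul, smul_eq_mul, ← mul_assoc, h3]
  rw [h1]
  simp_rw [h2]
  rw [integral_const_mul]
  congr 1
  exact integral_add_right_eq_self (fun x : Torus => fourier (-k) x • u x) h

lemma sobolevNorm_translate (s : ℕ) (h : Torus) (u : L2) :
    sobolevNorm s (translate h u) = sobolevNorm s u := by
  unfold sobolevNorm
  congr 1
  refine tsum_congr fun k => ?_
  rw [coeff_translate, norm_mul, fourier_apply, Circle.norm_coe, one_mul]

/-- The coefficients and the forcing do not depend on `x`, so the equation commutes with
translations. -/
lemma IsSolutionOn.translate {d ζ f κ : ℝ} {J : Set ℝ} {a : ℝ → L2}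
    (ha : IsSolutionOn d ζ f κ a J) (h : Torus) :
    IsSolutionOn d ζ f κ (fun t => translate h (a t)) J := by
  obtain ⟨hc, at', axx, hcont, ha⟩ := ha
  refine ⟨fun t ht => ?_, fun t => LLE.translate h (at' t), fun t => LLE.translate h (axx t),
    (LLE.translate h).continuous.comp_continuousOn hcont, fun t ht => ⟨?_, fun k => ?_, ?_⟩⟩
  · simp only [← map_sub, MemH, sobolevNorm_translate]
    exact hc t ht
  · exact ((LLE.translate h).hasFDerivAt.comp_hasDerivWithinAt t (ha t ht).1)
  · rw [coeff_translate, coeff_translate, (ha t ht).2.1 k]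
    ring
  · filter_upwards [translate_ae h (at' t), translate_ae h (axx t), translate_ae h (a t),
      (measurePreserving_add_torus h).quasiMeasurePreserving.ae (ha t ht).2.2] with x h1 h2 h3 h4
    rw [h1, h2, h3, h4]

/-- The `L²` norm of the derivative decays exponentially along solutions. -/
lemma IsSolutionOn.sum_deriv_le {d ζ f κ : ℝ} (hκ : 1 / Real.sqrt 3 ≤ κ) {J : Set ℝ}
    (hJ : Convex ℝ J) {a : ℝ → L2} (ha : IsSolutionOn d ζ f κ a J) {t : ℝ} (h0 : (0 : ℝ) ∈ J)
    (ht : t ∈ J) (ht0 : 0 ≤ t) {B : ℝ}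
    (hB : HasSum (fun k : ℤ => (k : ℝ) ^ 2 * ‖coeff (a 0) k‖ ^ 2) B) (F : Finset ℤ) :
    ∑ k ∈ F, (k : ℝ) ^ 2 * ‖coeff (a t) k‖ ^ 2 ≤ Real.exp (-t) ^ 2 * B := by
  have hsq : ∀ (h : Torus) (u : L2), HasSum (fun k => ‖(fourier k h : ℂ) - 1‖ ^ 2 * ‖coeff u k‖ ^ 2)
      (‖LLE.translate h u - u‖ ^ 2) := by
    intro h u
    convert hasSum_norm_coeff_sq (LLE.translate h u - u) using 2 with k
    rw [coeff_sub, coeff_translate, ← sub_one_mul, norm_mul, mul_pow]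
  have hexp : ∀ (h : ℝ) (k : ℤ), (fourier k (h : Torus) : ℂ) = Complex.exp (Complex.I * (k * h : ℝ)) := by
    intro h k
    rw [fourier_coe_apply]
    congr 1
    have : (Real.pi : ℂ) ≠ 0 := by exact_mod_cast Real.pi_ne_zero
    push_cast
    field_simp
  -- The contraction is applied to the solution and its translate by `h`; at time 0, |e^{ikh} - 1| ≤
  -- |kh| bounds their distance.
  have hle : ∀ h : ℝ, ∑ k ∈ F, ‖(fourier k (h : Torus) : ℂ) - 1‖ ^ 2 * ‖coeff (a t) k‖ ^ 2
      ≤ h ^ 2 * (Real.exp (-t) ^ 2 * B) := by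
    intro h
    calc _ ≤ ‖LLE.translate (h : Torus) (a t) - a t‖ ^ 2 :=
          sum_le_hasSum F (fun _ _ => by positivity) (hsq _ _)
      _ ≤ (Real.exp (-t) * ‖LLE.translate (h : Torus) (a 0) - a 0‖) ^ 2 := by
          gcongr
          simpa using (ha.translate (h : Torus)).norm_sub_le hκ hJ ha h0 ht ht0
      _ = Real.exp (-t) ^ 2 * ‖LLE.translate (h : Torus) (a 0) - a 0‖ ^ 2 := mul_pow _ _ _
      _ ≤ Real.exp (-t) ^ 2 * (h ^ 2 * B) := by
          gcongr
          refine hasSum_le (fun k => ?_) (hsq _ _) (hB.mul_left (h ^ 2))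
          rw [← mul_assoc]
          gcongr
          have := Real.norm_exp_I_mul_ofReal_sub_one_le (x := k * h)
          rw [hexp]
          calc _ ≤ ‖(k : ℝ) * h‖ ^ 2 := by gcongr
            _ = _ := by rw [Real.norm_eq_abs, sq_abs]; ring
      _ = _ := by ring
  -- Dividing by h² and letting h → 0 recovers the weight k²; the sum over `F` is finite, so the
  -- limit passes through it.
  have hlim : ∀ k : ℤ, Tendsto (fun h : ℝ => ‖(fourier k (h : Torus) : ℂ) - 1‖ ^ 2 / h ^ 2) (𝓝[≠] 0)
      (𝓝 ((k : ℝ) ^ 2)) := by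
    intro k
    have h1 : HasDerivAt (fun h : ℝ => Complex.exp (Complex.I * (k * h : ℝ))) (Complex.I * k) 0 := by
      have h2 : HasDerivAt (fun h : ℝ => Complex.I * ((k * h : ℝ) : ℂ)) (Complex.I * k) 0 := by
        have := ((hasDerivAt_id (0 : ℝ)).const_mul (k : ℝ)).ofReal_comp.const_mul Complex.I
        simpa using this
      simpa using h2.cexp
    have h3 := (hasDerivAt_iff_tendsto_slope.mp h1).norm.pow 2
    simp only [norm_mul, Complex.norm_I, one_mul, Complex.norm_intCast, sq_abs] at h3
    refine h3.congr fun h => ?_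
    rw [slope_def_module, hexp, norm_smul, mul_pow, sub_zero, norm_inv, inv_pow, Real.norm_eq_abs,
      sq_abs]
    simp [div_eq_inv_mul]
  refine le_of_tendsto (tendsto_finsetSum F fun k _ => (hlim k).mul_const (‖coeff (a t) k‖ ^ 2)) ?_
  filter_upwards [self_mem_nhdsWithin] with h hh
  have hh' : 0 < h ^ 2 := by have : h ≠ 0 := hh; positivity
  have := hle h
  simp_rw [div_mul_eq_mul_div]
  rw [← Finset.sum_div, div_le_iff₀ hh']
  linarith

end Contraction

/-! ### The constant equilibrium and uniqueness of stationary solutions. -/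

section Equilibrium

/-- With r = |c|² the equation reads c = f/q, q = (1 + κr) + i(ζ - r). It is solvable once r|q|² =
f², and the intermediate value theorem gives such an `r` in [0, f²], since |q| ≥ 1 there. -/
lemma exists_equilibrium (d ζ f : ℝ) {κ : ℝ} (hκ : 0 < κ) : ∃ c : ℂ, rhs d ζ f κ c 0 = 0 := by
  let g : ℝ → ℝ := fun r => r * ((1 + κ * r) ^ 2 + (ζ - r) ^ 2)
  have hg : Continuous g := by fun_prop
  obtain ⟨r, hr, hgr⟩ : ∃ r ∈ Icc (0 : ℝ) (f ^ 2), g r = f ^ 2 := by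
    refine intermediate_value_Icc (sq_nonneg f) hg.continuousOn ⟨by simpa [g] using sq_nonneg f, ?_⟩
    have : 1 ≤ (1 + κ * f ^ 2) ^ 2 := one_le_pow₀ (by nlinarith [sq_nonneg f])
    simp only [g]
    nlinarith [sq_nonneg f, sq_nonneg (ζ - f ^ 2)]
  set q : ℂ := ⟨1 + κ * r, ζ - r⟩ with hq
  have hq0 : q ≠ 0 := by
    intro h
    have := congrArg Complex.re h
    simp only [hq, Complex.zero_re] at this
    nlinarith [hr.1]
  have hqn : ‖q‖ ^ 2 = (1 + κ * r) ^ 2 + (ζ - r) ^ 2 := by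
    rw [← Complex.normSq_eq_norm_sq, Complex.normSq_apply]; ring
  have hqn0 : ‖q‖ ^ 2 ≠ 0 := by positivity
  have hc : ‖(f : ℂ) / q‖ ^ 2 = r := by
    rw [norm_div, div_pow, div_eq_iff hqn0, hqn, Complex.norm_real, Real.norm_eq_abs, sq_abs]
    exact hgr.symm
  refine ⟨f / q, ?_⟩
  have h2 : f / q * q = f := div_mul_cancel₀ _ hq0
  have h3 : q = (1 + κ * r) + (ζ - r) * Complex.I := by
    apply Complex.ext <;> simp [hq]
  rw [rhs, ← Complex.ofReal_pow, hc, ← h2]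
  conv_lhs => rw [h2]
  have h4 : (f : ℂ) = f / q * ((1 + κ * r) + (ζ - r) * Complex.I) := by rw [← h3, h2]
  rw [show Complex.I * (f : ℂ) = Complex.I * (f / q * ((1 + κ * r) + (ζ - r) * Complex.I)) by
    rw [← h4]]
  linear_combination (f / q * (ζ - r)) * Complex.I_sq

lemma IsStationary.isSolutionOn {d ζ f κ : ℝ} {u : L2} (h : IsStationary d ζ f κ u) (J : Set ℝ) :
    IsSolutionOn d ζ f κ (fun _ => u) J := by
  obtain ⟨hu, uxx, huxx, hae⟩ := h
  refine ⟨fun t _ => ⟨hu, ?_⟩, fun _ => 0, fun _ => uxx, continuousOn_const, fun t _ =>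
    ⟨hasDerivWithinAt_const _ _ _, huxx, ?_⟩⟩
  · have : sobolevNorm 2 (u - u) = 0 := by simp [sobolevNorm, coeff_eq_repr]
    simp only [this]
    exact tendsto_const_nhds
  · filter_upwards [hae, Lp.coeFn_zero ℂ 2 (AddCircle.haarAddCircle (T := 2 * Real.pi))] with x h1 h2
    rw [h1, h2]
    simp

lemma isStationary_const {d ζ f κ : ℝ} {c : ℂ} (hc : rhs d ζ f κ c 0 = 0) :
    IsStationary d ζ f κ (const c) := by
  refine ⟨?_, 0, fun k => ?_, ?_⟩
  · rw [← smoothing_const]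
    exact memH_smoothing (by norm_num) _
  · rw [coeff_const, coeff_eq_repr]
    rcases eq_or_ne k 0 with h | h <;> simp [h]
  · filter_upwards [const_ae c, Lp.coeFn_zero ℂ 2 (AddCircle.haarAddCircle (T := 2 * Real.pi))]
      with x h1 h2
    rw [h1, h2]
    exact hc

/-- Stationary solutions are unique. -/
lemma IsStationary.eq {d ζ f κ : ℝ} (hκ : 1 / Real.sqrt 3 ≤ κ) {u v : L2}
    (hu : IsStationary d ζ f κ u) (hv : IsStationary d ζ f κ v) : u = v := by
  have h := (hu.isSolutionOn univ).norm_sub_le hκ convex_univ (hv.isSolutionOn univ)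
    (mem_univ 0) (mem_univ 1) zero_le_one
  -- A time-independent distance that shrinks by the factor e⁻¹ must vanish.
  have h1 : Real.exp (-(1 - 0)) < 1 := by rw [Real.exp_lt_one_iff]; norm_num
  rw [← sub_eq_zero, ← norm_eq_zero]
  nlinarith [norm_nonneg (u - v)]

end Equilibrium

/-! ### Global solutions of locally Lipschitz equations with an a priori bound. -/

section GlobalODE

open scoped NNReal
open Metric

variable {E : Type*} [NormedAddCommGroup E] [NormedSpace ℝ E]

/-- `v` solves the initial value problem `v' = G(t, v)`, `v(0) = x₀` on `J`. -/
def SolvesOn (G : ℝ → E → E) (x₀ : E) (v : ℝ → E) (J : Set ℝ) : Prop :=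
  v 0 = x₀ ∧ ∀ t ∈ J, HasDerivWithinAt v (G t (v t)) J t

lemma SolvesOn.mono {G : ℝ → E → E} {x₀ : E} {v : ℝ → E} {J J' : Set ℝ} (h : SolvesOn G x₀ v J)
    (hJ : J' ⊆ J) : SolvesOn G x₀ v J' :=
  ⟨h.1, fun t ht => (h.2 t (hJ ht)).mono hJ⟩

lemma SolvesOn.continuousOn {G : ℝ → E → E} {x₀ : E} {v : ℝ → E} {J : Set ℝ}
    (h : SolvesOn G x₀ v J) : ContinuousOn v J := fun t ht => (h.2 t ht).continuousWithinAt

lemma SolvesOn.hasDerivWithinAt_Ici {G : ℝ → E → E} {x₀ : E} {v : ℝ → E} {T t : ℝ}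
    (h : SolvesOn G x₀ v (Icc 0 T)) (ht : t ∈ Ico 0 T) :
    HasDerivWithinAt v (G t (v t)) (Ici t) t :=
  (h.2 t (Ico_subset_Icc_self ht)).mono_of_mem_nhdsWithin (Icc_mem_nhdsGE_of_mem ht)

lemma SolvesOn.eq {G : ℝ → E → E} {x₀ : E} {K : ℝ → ℝ≥0}
    (hK : ∀ R t, LipschitzOnWith (K R) (G t) (closedBall 0 R)) {v w : ℝ → E} {t : ℝ} (ht : 0 ≤ t)
    (hv : SolvesOn G x₀ v (Icc 0 t)) (hw : SolvesOn G x₀ w (Icc 0 t)) : v t = w t := by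
  obtain ⟨R₁, hR₁⟩ := isCompact_Icc.exists_bound_of_continuousOn hv.continuousOn
  obtain ⟨R₂, hR₂⟩ := isCompact_Icc.exists_bound_of_continuousOn hw.continuousOn
  refine ODE_solution_unique_of_mem_Icc_right (v := G) (s := fun _ => closedBall 0 (max R₁ R₂))
    (fun s _ => hK _ s) hv.continuousOn (fun s hs => hv.hasDerivWithinAt_Ici hs)
    (fun s hs => ?_) hw.continuousOn (fun s hs => hw.hasDerivWithinAt_Ici hs) (fun s hs => ?_)
    (hv.1.trans hw.1.symm) ⟨ht, le_rfl⟩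
  · exact mem_closedBall_zero_iff.mpr ((hR₁ s (Ico_subset_Icc_self hs)).trans (le_max_left _ _))
  · exact mem_closedBall_zero_iff.mpr ((hR₂ s (Ico_subset_Icc_self hs)).trans (le_max_right _ _))

lemma SolvesOn.extend {G : ℝ → E → E} {x₀ : E} {v α : ℝ → E} {T T' : ℝ} (hT : 0 ≤ T) (hT' : T ≤ T')
    (hv : SolvesOn G x₀ v (Icc 0 T)) (hα : α T = v T)
    (hα' : ∀ t ∈ Icc T T', HasDerivWithinAt α (G t (α t)) (Icc T T') t) :
    ∃ w, SolvesOn G x₀ w (Icc 0 T') := by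
  classical
  let w : ℝ → E := fun t => if t ≤ T then v t else α t
  have hw1 : ∀ t ∈ Icc 0 T, w t = v t := fun t ht => if_pos ht.2
  have hw2 : ∀ t ∈ Icc T T', w t = α t := by
    intro t ht
    rcases ht.1.eq_or_lt with h | h
    · rw [← h, hα]; exact if_pos le_rfl
    · exact if_neg h.not_ge
  have hd1 : ∀ t, HasDerivWithinAt w (G t (w t)) (Icc 0 T) t := by
    intro t
    by_cases ht : t ∈ Icc 0 T
    · rw [hw1 t ht]
      exact (hv.2 t ht).congr hw1 (hw1 t ht)
    -- Off the closed interval the derivative within it is vacuous, so both one-sided statements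
    -- hold for every `t` and can be joined by `union`.
    · exact HasFDerivWithinAt.of_notMem_closure (by rwa [isClosed_Icc.closure_eq])
  have hd2 : ∀ t, HasDerivWithinAt w (G t (w t)) (Icc T T') t := by
    intro t
    by_cases ht : t ∈ Icc T T'
    · rw [hw2 t ht]
      exact (hα' t ht).congr hw2 (hw2 t ht)
    · exact HasFDerivWithinAt.of_notMem_closure (by rwa [isClosed_Icc.closure_eq])
  refine ⟨w, (hw1 0 ⟨le_rfl, hT⟩).trans hv.1, fun t _ => ?_⟩
  rw [← Icc_union_Icc_eq_Icc hT hT']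
  exact (hd1 t).union (hd2 t)

/-- A locally Lipschitz differential equation has a global solution if its solutions satisfy an
a priori bound. -/
theorem exists_global_solution [CompleteSpace E] {G : ℝ → E → E} {x₀ : E} {K : ℝ → ℝ≥0} {C : ℝ≥0}
    (hK : ∀ R t, LipschitzOnWith (K R) (G t) (closedBall 0 R)) (hC : ∀ t, ‖G t 0‖ ≤ C)
    (hG : ∀ x, Continuous fun t => G t x)
    (hap : ∀ N : ℝ, ∃ R : ℝ, ∀ T ∈ Icc 0 N, ∀ v, SolvesOn G x₀ v (Icc 0 T) → ‖v T‖ ≤ R) :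
    ∃ v, SolvesOn G x₀ v (Ici 0) := by
  -- The extension time depends only on the bound `R` for the current value.
  have hstep : ∀ R : ℝ, 0 ≤ R → ∃ τ > 0, ∀ T, 0 ≤ T → ∀ v, SolvesOn G x₀ v (Icc 0 T) → ‖v T‖ ≤ R →
      ∃ w, SolvesOn G x₀ w (Icc 0 (T + τ)) := by
    intro R hR
    -- `L` bounds the field on the ball of radius R + 1. Over time 1/(L + 1) the solution moves by
    -- less than 1 and stays in that ball.
    let L : ℝ≥0 := K (R + 1) * (R + 1).toNNReal + C
    have hτ : 0 < (1 : ℝ) / (L + 1) := by positivity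
    refine ⟨1 / (L + 1), hτ, fun T hT v hv hvR => ?_⟩
    have hsub : closedBall (v T) ((1 : ℝ≥0) : ℝ) ⊆ closedBall 0 (R + 1) := by
      intro x hx
      rw [mem_closedBall, dist_eq_norm] at hx
      rw [mem_closedBall_zero_iff]
      calc ‖x‖ = ‖(x - v T) + v T‖ := by rw [sub_add_cancel]
        _ ≤ ‖x - v T‖ + ‖v T‖ := norm_add_le _ _
        _ ≤ 1 + R := add_le_add hx hvR
        _ = R + 1 := add_comm _ _
    have hPL : IsPicardLindelof G (tmin := T) (tmax := T + 1 / (L + 1)) ⟨T, le_rfl, by linarith⟩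
        (v T) 1 0 L (K (R + 1)) := by
      refine ⟨fun t _ => (hK _ t).mono hsub, fun x _ => (hG x).continuousOn, fun t _ x hx => ?_, ?_⟩
      · have hx' := hsub hx
        have h1 := (hK (R + 1) t).dist_le_mul x hx' 0 (by simpa using by linarith)
        rw [dist_zero_right, dist_eq_norm] at h1
        calc ‖G t x‖ = ‖(G t x - G t 0) + G t 0‖ := by rw [sub_add_cancel]
          _ ≤ K (R + 1) * ‖x‖ + C := (norm_add_le _ _).trans (add_le_add h1 (hC t))
          _ ≤ K (R + 1) * (R + 1) + C := by
              gcongr; exact mem_closedBall_zero_iff.mp hx'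
          _ = L := by
              simp only [L, NNReal.coe_add, NNReal.coe_mul, Real.coe_toNNReal _ (by linarith : 0 ≤ R + 1)]
      · change (L : ℝ) * max (T + 1 / (L + 1) - T) (T - T) ≤ 1 - 0
        rw [add_sub_cancel_left, sub_self, max_eq_left hτ.le, mul_one_div, div_le_iff₀ (by positivity)]
        simp
    obtain ⟨α, hα, hα'⟩ := hPL.exists_eq_forall_mem_Icc_hasDerivWithinAt (mem_closedBall_self (by simp))
    exact hv.extend hT (by linarith) hα hα'
  have hN : ∀ N : ℕ, ∃ v, SolvesOn G x₀ v (Icc 0 (N : ℝ)) := by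
    intro N
    obtain ⟨R, hR⟩ := hap N
    obtain ⟨τ, hτ, hs⟩ := hstep (max R 0) (le_max_right _ _)
    -- Steps of length `τ`, capped at `N` so that the a priori bound for [0, N] keeps applying.
    have hind : ∀ n : ℕ, ∃ v, SolvesOn G x₀ v (Icc 0 (min (n * τ) N)) := by
      intro n
      induction n with
      | zero =>
        refine ⟨fun t => x₀ + t • G 0 x₀, by simp, fun t ht => ?_⟩
        have ht0 : t = 0 := by
          have := ht.2
          simp only [Nat.cast_zero, zero_mul, Nat.cast_nonneg, min_eq_left] at this
          exact le_antisymm this ht.1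
        subst ht0
        have := ((hasDerivAt_id (0 : ℝ)).smul_const (G 0 x₀)).const_add x₀
        simpa using this.hasDerivWithinAt
      | succ n ih =>
        obtain ⟨v, hv⟩ := ih
        have h0 : (0 : ℝ) ≤ min (n * τ) N := le_min (by positivity) (by positivity)
        obtain ⟨w, hw⟩ := hs _ h0 v hv
          ((hR _ ⟨h0, min_le_right _ _⟩ v hv).trans (le_max_left _ _))
        refine ⟨w, hw.mono (Icc_subset_Icc_right ?_)⟩
        push_cast
        rcases le_total (n * τ) N with h | h
        · rw [min_eq_left h]
          refine (min_le_left _ _).trans (by linarith)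
        · rw [min_eq_right h]
          refine (min_le_right _ _).trans (by linarith)
    obtain ⟨n, hn⟩ := exists_nat_ge (N / τ)
    obtain ⟨v, hv⟩ := hind n
    rw [div_le_iff₀ hτ] at hn
    rw [min_eq_right hn] at hv
    exact ⟨v, hv⟩
  choose v hv using hN
  -- Time `t` lies in [0, ⌊t⌋ + 1]; uniqueness makes the choice of interval irrelevant.
  let V : ℝ → E := fun t => v (⌊t⌋₊ + 1) t
  have hV : ∀ (n : ℕ), ∀ t ∈ Icc 0 (n : ℝ), V t = v n t := by
    intro n t ht
    refine SolvesOn.eq (v := v (⌊t⌋₊ + 1)) hK ht.1 ((hv _).mono (Icc_subset_Icc_right ?_))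
      ((hv n).mono (Icc_subset_Icc_right ht.2))
    push_cast
    exact (Nat.lt_floor_add_one t).le
  refine ⟨V, (hV 0 0 (by simp)).trans (hv 0).1, fun t ht => ?_⟩
  obtain ⟨n, hn⟩ := exists_nat_gt t
  have htn : t ∈ Icc 0 (n : ℝ) := ⟨ht, hn.le⟩
  have h1 : HasDerivWithinAt V (G t (V t)) (Icc 0 (n : ℝ)) t := by
    rw [hV n t htn]
    exact ((hv n).2 t htn).congr (hV n) (hV n t htn)
  refine h1.mono_of_mem_nhdsWithin ?_
  rw [← Ici_inter_Iic]
  exact inter_mem_nhdsWithin _ (Iic_mem_nhds hn)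

end GlobalODE

/-! ### Global existence in H⁴ and convergence to the equilibrium. -/

section Evolution

open scoped NNReal

/-- The vector field of the equation in the interaction picture, on `H⁴` transported to `L²`. -/
noncomputable def field (d ζ f κ t : ℝ) (v : L2) : L2 :=
  -v + propagator d ζ (-t) ((Complex.I - κ) • nonlin (propagator d ζ t v) + const f)

lemma norm_field_sub_le (d ζ f κ t : ℝ) {R : ℝ} {v w : L2} (hv : ‖v‖ ≤ R) (hw : ‖w‖ ≤ R) :
    ‖field d ζ f κ t v - field d ζ f κ t w‖
      ≤ (1 + ‖Complex.I - κ‖ * (lipConst * R ^ 2)) * ‖v - w‖ := by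
  have e : field d ζ f κ t v - field d ζ f κ t w = -(v - w) + propagator d ζ (-t)
      ((Complex.I - κ) • (nonlin (propagator d ζ t v) - nonlin (propagator d ζ t w))) := by
    simp only [field, map_add, map_smul, map_sub, smul_sub]
    abel
  rw [e]
  refine (norm_add_le _ _).trans ?_
  rw [norm_neg, norm_propagator, norm_smul, add_mul, one_mul, mul_assoc]
  gcongr
  refine (norm_nonlin_sub_le (R := R) (by rwa [norm_propagator]) (by rwa [norm_propagator])).trans_eq ?_
  rw [← map_sub, norm_propagator]

lemma continuous_field (d ζ f κ : ℝ) (v : L2) : Continuous fun t => field d ζ f κ t v := by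
  unfold field
  have h0 : Continuous fun t => nonlin (propagator d ζ t v) :=
    continuous_nonlin.comp (continuous_propagator_apply d ζ v)
  have h1 : Continuous fun t => (Complex.I - (κ : ℂ)) • nonlin (propagator d ζ t v) + const f := by
    fun_prop
  exact continuous_const.add ((continuous_propagator d ζ).comp
    (f := fun t => (-t, (Complex.I - (κ : ℂ)) • nonlin (propagator d ζ t v) + const f))
    (continuous_neg.prodMk h1))

lemma SolvesOn.continuousOn_propagator {d ζ f κ : ℝ} {x₀ : L2} {v : ℝ → L2} {J : Set ℝ}
    (hv : SolvesOn (field d ζ f κ) x₀ v J) : ContinuousOn (fun t => propagator d ζ t (v t)) J :=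
  (continuous_propagator d ζ).comp_continuousOn (f := fun t => (t, v t))
    (continuousOn_id.prodMk hv.continuousOn)

lemma continuousInH_smoothing {s : ℕ} (hs : s ≤ 4) {y : ℝ → L2} {J : Set ℝ}
    (hy : ContinuousOn y J) : ContinuousInH s (fun t => smoothing (y t)) J := by
  intro t ht
  refine ⟨memH_smoothing hs _, ?_⟩
  have h1 : Tendsto (fun r => ENNReal.ofReal ‖y r - y t‖) (𝓝[J] t) (𝓝 0) := by
    have := (ENNReal.continuous_ofReal.tendsto 0).comp (tendsto_iff_norm_sub_tendsto_zero.mp (hy t ht))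
    simpa only [Function.comp_def, ENNReal.ofReal_zero] using this
  refine tendsto_of_tendsto_of_tendsto_of_le_of_le tendsto_const_nhds h1 (fun _ => zero_le)
    fun r => ?_
  simp only [← map_sub]
  exact sobolevNorm_smoothing_le hs _

lemma SolvesOn.isSolutionOn {d ζ f κ : ℝ} {x₀ : L2} {v : ℝ → L2} {J : Set ℝ}
    (hv : SolvesOn (field d ζ f κ) x₀ v J) :
    IsSolutionOn d ζ f κ (fun t => smoothing (propagator d ζ t (v t))) J := by
  have hy := hv.continuousOn_propagator
  -- `Φ` gives the time derivative of the solution as a continuous function of y = (1 - ∂²)²a in L²;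
  -- this yields the C¹ regularity.
  let Φ : L2 → L2 := fun y => ((-Complex.I * ζ) • smoothing y + (Complex.I * d) • smoothingDeriv y)
    + (-smoothing y + ((Complex.I - κ) • smoothing (nonlin y) + const f))
  have hΦ : Continuous Φ := by
    have := continuous_nonlin
    fun_prop
  have hΦ_ae : ∀ y, ∀ᵐ x ∂(AddCircle.haarAddCircle (T := 2 * Real.pi)),
      Complex.I * Φ y x = rhs d ζ f κ (smoothing y x) (smoothingDeriv y x) := by
    intro y
    filter_upwards [smoothing_nonlin_ae y, const_ae (f : ℂ),
      Lp.coeFn_add ((-Complex.I * ζ) • smoothing y + (Complex.I * d) • smoothingDeriv y)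
        (-smoothing y + ((Complex.I - κ) • smoothing (nonlin y) + const f)),
      Lp.coeFn_add ((-Complex.I * ζ) • smoothing y) ((Complex.I * d) • smoothingDeriv y),
      Lp.coeFn_add (-smoothing y) ((Complex.I - κ) • smoothing (nonlin y) + const f),
      Lp.coeFn_add ((Complex.I - (κ : ℂ)) • smoothing (nonlin y)) (const f),
      Lp.coeFn_neg (smoothing y), Lp.coeFn_smul (-Complex.I * (ζ : ℂ)) (smoothing y),
      Lp.coeFn_smul (Complex.I * (d : ℂ)) (smoothingDeriv y),
      Lp.coeFn_smul (Complex.I - (κ : ℂ)) (smoothing (nonlin y))]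
      with x h1 h2 h3 h4 h5 h6 h7 h8 h9 h10
    simp only [Φ, h1, h2, h3, h4, h5, h6, h7, h8, h9, h10, Pi.add_apply, Pi.neg_apply,
      Pi.smul_apply, smul_eq_mul, rhs]
    linear_combination (-ζ * smoothing y x + d * smoothingDeriv y x +
      (‖smoothing y x‖ : ℂ) ^ 2 * smoothing y x) * Complex.I_sq
  refine ⟨continuousInH_smoothing (by norm_num) hy, fun t => Φ (propagator d ζ t (v t)),
    fun t => smoothingDeriv (propagator d ζ t (v t)), hΦ.comp_continuousOn hy,
    fun t ht => ⟨?_, fun k => coeff_smoothingDeriv _ _, ?_⟩⟩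
  · have h1 := (hasDerivAt_smoothing_propagator d ζ t).hasDerivWithinAt (s := J)
    refine (h1.clm_apply (hv.2 t ht)).congr_deriv ?_
    simp only [ContinuousLinearMap.coe_restrictScalars', ContinuousLinearMap.comp_apply, add_apply,
      smul_apply, field, map_add, map_neg, propagator_neg_apply, map_smul, smoothing_const, Φ]
  · exact hΦ_ae _

/-- A bound in `H¹` for all solutions with a given initial value. -/
lemma exists_sobolev_bound {d ζ f κ : ℝ} (hκ : 1 / Real.sqrt 3 ≤ κ) (x₀ : L2) :
    ∃ B : ℝ, 0 ≤ B ∧ ∀ T ≥ 0, ∀ a, IsSolutionOn d ζ f κ a (Icc 0 T) → a 0 = smoothing x₀ →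
      ∀ t ∈ Icc 0 T, ∀ F : Finset ℤ,
        ∑ k ∈ F, (1 + (k : ℝ) ^ 2) * ‖coeff (a t) k‖ ^ 2 ≤ B := by
  obtain ⟨c, hc⟩ := exists_equilibrium d ζ f (pos_and_one_le_of_inv_sqrt_three_le hκ).1
  have hs := (memH_smoothing (s := 1) (by norm_num) x₀).summable
  have hs' : Summable fun k : ℤ => (k : ℝ) ^ 2 * ‖coeff (smoothing x₀) k‖ ^ 2 := by
    refine hs.of_nonneg_of_le (fun _ => by positivity) fun k => ?_
    gcongr
    simp
  -- The first term bounds the L² norm through the distance to the equilibrium, the second is the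
  -- initial derivative norm; neither depends on `T`.
  refine ⟨(‖smoothing x₀ - const c‖ + ‖const c‖) ^ 2
    + ∑' k : ℤ, (k : ℝ) ^ 2 * ‖coeff (smoothing x₀) k‖ ^ 2,
    add_nonneg (by positivity) (tsum_nonneg fun _ => by positivity), fun T hT a ha ha0 t ht F => ?_⟩
  have h0 : (0 : ℝ) ∈ Icc 0 T := ⟨le_rfl, hT⟩
  have h1 := ha.norm_sub_le hκ (convex_Icc 0 T) ((isStationary_const hc).isSolutionOn _) h0 ht ht.1
  have h2 := ha.sum_deriv_le hκ (convex_Icc 0 T) h0 ht ht.1 (by rw [ha0]; exact hs'.hasSum) F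
  have he : Real.exp (-t) ≤ 1 := Real.exp_le_one_iff.mpr (by linarith [ht.1])
  have h3 : ‖a t‖ ≤ ‖smoothing x₀ - const c‖ + ‖const c‖ := by
    calc ‖a t‖ = ‖(a t - const c) + const c‖ := by rw [sub_add_cancel]
      _ ≤ ‖a t - const c‖ + ‖const c‖ := norm_add_le _ _
      _ ≤ _ := by
        gcongr
        refine h1.trans ?_
        rw [sub_zero, ha0]
        exact mul_le_of_le_one_left (norm_nonneg _) he
  calc _ = ∑ k ∈ F, ‖coeff (a t) k‖ ^ 2 + ∑ k ∈ F, (k : ℝ) ^ 2 * ‖coeff (a t) k‖ ^ 2 := by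
        rw [← Finset.sum_add_distrib]
        refine Finset.sum_congr rfl fun k _ => by ring
    _ ≤ ‖a t‖ ^ 2 + Real.exp (-t) ^ 2 * ∑' k : ℤ, (k : ℝ) ^ 2 * ‖coeff (smoothing x₀) k‖ ^ 2 :=
        add_le_add (sum_le_hasSum F (fun _ _ => by positivity) (hasSum_norm_coeff_sq _)) h2
    _ ≤ _ := by
        gcongr
        refine mul_le_of_le_one_left (tsum_nonneg fun _ => by positivity) ?_
        exact pow_le_one₀ (Real.exp_pos _).le he

/-- The H¹ bound controls the Wiener norm, so the tame estimate makes the cubic term at most linear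
in ‖v‖ and Gronwall's inequality applies. -/
lemma exists_apriori_bound {d ζ f κ : ℝ} (hκ : 1 / Real.sqrt 3 ≤ κ) (x₀ : L2) (N : ℝ) :
    ∃ R : ℝ, ∀ T ∈ Icc 0 N, ∀ v, SolvesOn (field d ζ f κ) x₀ v (Icc 0 T) → ‖v T‖ ≤ R := by
  obtain ⟨B, hB, hbound⟩ := exists_sobolev_bound (d := d) (ζ := ζ) (f := f) hκ x₀
  set A := embConst.toReal * B
  have hA : 0 ≤ A := by positivity
  set K := 1 + ‖Complex.I - κ‖ * (768 * A) with hKdef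
  have hcont : Continuous (gronwallBound ‖x₀‖ K ‖const f‖) :=
    continuous_iff_continuousAt.mpr fun x => (hasDerivAt_gronwallBound _ _ _ x).continuousAt
  obtain ⟨R, hR⟩ := isCompact_Icc.exists_bound_of_continuousOn
    (hcont.continuousOn (s := Icc 0 N))
  refine ⟨R, fun T hT v hv => ?_⟩
  have hsol := hv.isSolutionOn
  have h1 : ∀ t ∈ Icc 0 T, ‖nonlin (propagator d ζ t (v t))‖ ≤ 768 * A * ‖v t‖ := by
    intro t ht
    rw [← norm_propagator d ζ t (v t)]
    refine norm_nonlin_le_of_wienerNorm_le hA ((wienerNorm_sq_le _).trans ?_)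
    rw [ENNReal.ofReal_mul ENNReal.toReal_nonneg, ENNReal.ofReal_toReal embConst_ne_top]
    gcongr
    rw [ENNReal.tsum_eq_iSup_sum]
    refine iSup_le fun F => ?_
    rw [← ENNReal.ofReal_sum_of_nonneg (fun _ _ => by positivity), incl_embed]
    exact ENNReal.ofReal_le_ofReal
      (hbound T hT.1 _ hsol (by rw [propagator_zero, hv.1]) t ht F)
  have h2 := norm_le_gronwallBound_of_norm_deriv_right_le (δ := ‖x₀‖) (K := K) (ε := ‖const f‖)
    hv.continuousOn (fun t ht => hv.hasDerivWithinAt_Ici ht) (by rw [hv.1]) (fun t ht => by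
      have h3 := h1 t (Ico_subset_Icc_self ht)
      rw [field]
      calc _ ≤ ‖v t‖ + (‖Complex.I - κ‖ * ‖nonlin (propagator d ζ t (v t))‖ + ‖const f‖) := by
            refine (norm_add_le _ _).trans ?_
            rw [norm_neg, norm_propagator]
            gcongr
            refine (norm_add_le _ _).trans ?_
            rw [norm_smul]
        _ ≤ ‖v t‖ + (‖Complex.I - κ‖ * (768 * A * ‖v t‖) + ‖const f‖) := by gcongr
        _ = _ := by rw [hKdef]; ring) T ⟨hT.1, le_rfl⟩
  rw [sub_zero] at h2
  exact h2.trans ((le_abs_self _).trans (hR T hT))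

lemma exists_solvesOn {d ζ f κ : ℝ} (hκ : 1 / Real.sqrt 3 ≤ κ) (x₀ : L2) :
    ∃ v, SolvesOn (field d ζ f κ) x₀ v (Ici 0) := by
  refine exists_global_solution
    (K := fun R => (1 + ‖Complex.I - κ‖ * (lipConst * R ^ 2)).toNNReal)
    (C := (‖Complex.I - κ‖ * ‖nonlin 0‖ + ‖const f‖).toNNReal)
    (fun R t => LipschitzOnWith.of_dist_le_mul fun v hv w hw => ?_) (fun t => ?_)
    (continuous_field d ζ f κ) (exists_apriori_bound hκ x₀)
  · have := lipConst_nonneg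
    rw [dist_eq_norm, dist_eq_norm, Real.coe_toNNReal _ (by positivity)]
    exact norm_field_sub_le _ _ _ _ _ (mem_closedBall_zero_iff.mp hv) (mem_closedBall_zero_iff.mp hw)
  · rw [Real.coe_toNNReal _ (by positivity), field, neg_zero, zero_add, norm_propagator, map_zero]
    refine (norm_add_le _ _).trans ?_
    rw [norm_smul]

/-- Convergence in `H¹` of a global solution to the equilibrium. -/
lemma IsSolutionOn.tendsto_const {d ζ f κ : ℝ} (hκ : 1 / Real.sqrt 3 ≤ κ) {a : ℝ → L2}
    (ha : IsSolutionOn d ζ f κ a (Ici 0)) {c : ℂ} (hc : rhs d ζ f κ c 0 = 0) :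
    Tendsto (fun t => sobolevNorm 1 (a t - const c)) atTop (𝓝 0) := by
  have hs := MemH.summable ((ha.1 0 self_mem_Ici).1)
  have hs' : Summable fun k : ℤ => (k : ℝ) ^ 2 * ‖coeff (a 0) k‖ ^ 2 := by
    refine hs.of_nonneg_of_le (fun _ => by positivity) fun k => ?_
    exact mul_le_mul_of_nonneg_right (by nlinarith [sq_nonneg (k : ℝ), sq_nonneg ((k : ℝ) ^ 2)])
      (by positivity)
  set S := ∑' k : ℤ, (k : ℝ) ^ 2 * ‖coeff (a 0) k‖ ^ 2
  have hS : 0 ≤ S := tsum_nonneg fun _ => by positivity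
  have hle : ∀ t ≥ 0, sobolevNorm 1 (a t - const c)
      ≤ ENNReal.ofReal (Real.exp (-t) * Real.sqrt (‖a 0 - const c‖ ^ 2 + S)) := by
    intro t ht
    refine sobolevNorm_le_of_sum_le (by positivity) fun F => ?_
    have h1 := ha.norm_sub_le hκ (convex_Ici 0) ((isStationary_const hc).isSolutionOn _)
      self_mem_Ici (show t ∈ Ici 0 from ht) ht
    rw [sub_zero] at h1
    have h2 := ha.sum_deriv_le hκ (convex_Ici 0) self_mem_Ici (show t ∈ Ici 0 from ht) ht hs'.hasSum F
    rw [mul_pow, Real.sq_sqrt (by positivity), mul_add]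
    -- A constant lives in the mode k = 0 only, which the weight k² does not see.
    calc _ = ∑ k ∈ F, ‖coeff (a t - const c) k‖ ^ 2
          + ∑ k ∈ F, (k : ℝ) ^ 2 * ‖coeff (a t) k‖ ^ 2 := by
          rw [← Finset.sum_add_distrib]
          refine Finset.sum_congr rfl fun k _ => ?_
          rw [coeff_sub, coeff_const]
          split_ifs with h
          · simp [h]
          · simp; ring
      _ ≤ (Real.exp (-t) * ‖a 0 - const c‖) ^ 2 + Real.exp (-t) ^ 2 * S := by
          refine add_le_add ((sum_le_hasSum F (fun _ _ => by positivity)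
            (hasSum_norm_coeff_sq _)).trans ?_) h2
          gcongr
      _ = _ := by rw [mul_pow]
  have hlim : Tendsto (fun t => ENNReal.ofReal (Real.exp (-t) *
      Real.sqrt (‖a 0 - const c‖ ^ 2 + S))) atTop (𝓝 0) := by
    have h1 : Tendsto (fun t => Real.exp (-t) * Real.sqrt (‖a 0 - const c‖ ^ 2 + S)) atTop (𝓝 0) := by
      simpa using (Real.tendsto_exp_neg_atTop_nhds_zero.mul_const
        (Real.sqrt (‖a 0 - const c‖ ^ 2 + S)))
    simpa only [Function.comp_def, ENNReal.ofReal_zero] using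
      (ENNReal.continuous_ofReal.tendsto 0).comp h1
  exact tendsto_of_tendsto_of_tendsto_of_le_of_le' tendsto_const_nhds hlim
    (Eventually.of_forall fun _ => zero_le) ((eventually_ge_atTop 0).mono hle)

lemma IsSolutionOn.mono {d ζ f κ : ℝ} {a : ℝ → L2} {J J' : Set ℝ}
    (ha : IsSolutionOn d ζ f κ a J) (hJ : J' ⊆ J) : IsSolutionOn d ζ f κ a J' := by
  obtain ⟨hc, at', axx, hat, h⟩ := ha
  exact ⟨fun t ht => ⟨(hc t (hJ ht)).1, (hc t (hJ ht)).2.mono_left (nhdsWithin_mono t hJ)⟩,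
    at', axx, hat.mono hJ, fun t ht => ⟨(h t (hJ ht)).1.mono hJ, (h t (hJ ht)).2⟩⟩

end Evolution

end LLE

theorem theorem3 (d ζ f κ : ℝ) (hd : d ≠ 0) (hκ : 1 / Real.sqrt 3 ≤ κ) :
    (∀ φ : LLE.L2, LLE.MemH 4 φ →
      ∃ a : ℝ → LLE.L2,
        LLE.IsSolutionOn d ζ f κ a (Ici 0) ∧ a 0 = φ ∧
        (∀ T : ℝ, 0 < T → ∀ b : ℝ → LLE.L2,
          LLE.IsSolutionOn d ζ f κ b (Ico 0 T) → b 0 = φ → EqOn b a (Ico 0 T)) ∧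
        LLE.ContinuousInH 4 a (Ici 0) ∧
        ∃ c : ℂ, Tendsto (fun t => LLE.sobolevNorm 1 (a t - LLE.const c)) atTop (𝓝 0)) ∧
    (∀ u : LLE.L2, LLE.IsStationary d ζ f κ u → ∃ c : ℂ, u = LLE.const c) := by
  obtain ⟨c, hc⟩ := LLE.exists_equilibrium d ζ f (LLE.pos_and_one_le_of_inv_sqrt_three_le hκ).1
  refine ⟨fun φ hφ => ?_, fun u hu => ⟨c, hu.eq hκ (LLE.isStationary_const hc)⟩⟩
  obtain ⟨x₀, rfl⟩ := LLE.exists_smoothing_eq hφ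
  obtain ⟨v, hv⟩ := LLE.exists_solvesOn (d := d) (ζ := ζ) (f := f) hκ x₀
  have hsol := hv.isSolutionOn
  have h0 : LLE.smoothing (LLE.propagator d ζ 0 (v 0)) = LLE.smoothing x₀ := by
    rw [LLE.propagator_zero, hv.1]
  refine ⟨_, hsol, h0, fun T hT b hb hb0 t ht => ?_,
    LLE.continuousInH_smoothing le_rfl hv.continuousOn_propagator, c, hsol.tendsto_const hκ hc⟩
  -- Uniqueness: the contraction starting from initial distance zero.
  have h1 := hb.norm_sub_le hκ (convex_Ico 0 T) (hsol.mono Ico_subset_Ici_self)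
    (show (0 : ℝ) ∈ Ico 0 T from ⟨le_rfl, hT⟩) ht ht.1
  rw [hb0, h0, sub_self, norm_zero, mul_zero] at h1
  exact sub_eq_zero.mp (norm_le_zero_iff.mp h1)
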